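/- **Setting.** Let $d\ge 1$, $L>0$, $N\ge 2$ even, and let $\mathcal F^N$ be the $N$-particle sector of the bosonic Fock space over $L^2$ of the $d$-dimensional periodic box of side $L$, with annihilation operators $a_{\mathbf j}$ of the plane-wave modes $\mathbf j\in\mathbb Z^d$, $k_{\mathbf j}=\frac{2\pi}{L}\mathbf j$, and $\Delta_0=\min_{\mathbf j\ne 0}k_{\mathbf j}^2$. Fix a mode $\mathbf j_*\neq 0$ and a Fourier component $\phi=\phi_{\mathbf j_*}>0$ of the pair potential, and put $k^2=k_{\mathbf j_*}^2$, $\epsilon=k^2/\phi$, $E^{Bog}=-[k^2+\phi-\sqrt{k^4+2\phi k^2}]$, $$W=\frac{\phi}{N}a_0^*a_0^*a_{\mathbf j_*}a_{-\mathbf j_*},\qquad H=\sum_{\mathbf j\ne\pm\mathbf j_*}k_{\mathbf j}^2a_{\mathbf j}^*a_{\mathbf j}+\Big(k^2+\frac{\phi}{N}a_0^*a_0\Big)(a_{\mathbf j_*}^*a_{\mathbf j_*}+a_{-\mathbf j_*}^*a_{-\mathbf j_*})+W+W^*$$ on $\mathcal F^N$. For even $0\le i\le N-2$ let $Q_i$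 be the orthogonal projection onto the states with $N-i$ or $N-i-1$ particles in the modes $\pm\mathbf j_*$, and for real $z$ put $R_{i}(z)=Q_i\,\frac{1}{Q_i(H-z)Q_i}\,Q_i$ (inverse taken on $Q_i\mathcal F^N$), $W_{i,i-2}=Q_iWQ_{i-2}$, $W^*_{i-2,i}=Q_{i-2}W^*Q_i$. Define recursively $$\Gamma_2(z)=W_{2,0}R_0(z)W^*_{0,2},\qquad \Gamma_i(z)=W_{i,i-2}R_{i-2}(z)\sum_{l=0}^\infty[\Gamma_{i-2}(z)R_{i-2}(z)]^l\,W^*_{i-2,i}\quad(i\ge4),$$ $$\check\Gamma_0(z)=1,\qquad \check\Gamma_i(z)=\sum_{l=0}^\infty\big[R_i(z)^{1/2}\,\Gamma_i(z)\,R_i(z)^{1/2}\big]^l\quad(i\ge 2),$$ $$A(z)=W\,R_{N-2}(z)^{1/2}\,\check\Gamma_{N-2}(z)\,R_{N-2}(z)^{1/2}\,W^*.$$ Let $\eta$ be the normalized state with all $N$ particles in the zero mode, $P_\eta=|\eta\rangle\langle\eta|$, and $\overline{P_\eta}=Q^{(0)}-P_\eta$, where $Q^{(0)}$ is the orthogonal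 projection onto the states without particles in the modes $\pm\mathbf j_*$. **Statement.** Let $\nu>\frac{11}{8}$, $0<\mu<1$, $\theta>0$, $K>0$. There are $\epsilon_0,C,c>0$, depending only on $\nu,\mu,\theta,K$, such that whenever $$\epsilon\le\epsilon_0,\qquad \frac1N\le\epsilon^\nu,\qquad \frac{\phi}{\Delta_0}\,\frac{N^\mu}{N(N-N^\mu)}<\frac12,\qquad \frac1{N^\mu}\le K(\sqrt\epsilon)^{1+\theta},$$ the following holds for every real $z<E^{Bog}+\sqrt\epsilon\,\phi\sqrt{\epsilon^2+2\epsilon}$. At both spectral parameters $z$ and $z-\frac{\Delta_0}2$ all objects above are well defined (the $R_i$ exist as bounded positive operators and all the series converge in operator norm), and $$\big\|\overline{P_\eta}\,A(z)\,\overline{P_\eta}\big\|\;\le\;\big\|P_\eta\,A\big(z-\tfrac{\Delta_0}{2}\big)\,P_\eta\big\|+\frac{C}{\sqrt\epsilon}\Big(\frac{1}{1+c\sqrt\epsilon}\Big)^{N^\mu}.$$ -/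

import Mathlib

open scoped ENNReal InnerProductSpace

noncomputable section

namespace Bog

/-! ### Fock space sectors in the occupation number representation -/

/-- Modes: the mode `j : Mode d` stands for the plane wave of wave vector `(2π/L) j`. -/
abbrev Mode (d : ℕ) := Fin d → ℤ

/-- Occupation numbers of the modes, with total particle number `n`. -/
abbrev Occ (d n : ℕ) := {c : Mode d →₀ ℕ // c.degree = n}

/-- The `n`-particle sector of the bosonic Fock space over `L²` of the periodic box: its
orthonormal basis of normalized product states of plane waves is indexed by `Occ d n`. -/
def Sector (d n : ℕ) : Type := lp (fun _ : Occ d n => ℂ) 2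

instance (d n : ℕ) : NormedAddCommGroup (Sector d n) :=
  inferInstanceAs (NormedAddCommGroup (lp (fun _ : Occ d n => ℂ) 2))

instance (d n : ℕ) : InnerProductSpace ℂ (Sector d n) :=
  inferInstanceAs (InnerProductSpace ℂ (lp (fun _ : Occ d n => ℂ) 2))

instance (d n : ℕ) : CompleteSpace (Sector d n) :=
  inferInstanceAs (CompleteSpace (lp (fun _ : Occ d n => ℂ) 2))

/-- A vector of the sector as a square summable family of coefficients. -/
def Sector.toLp {d n : ℕ} (f : Sector d n) : lp (fun _ : Occ d n => ℂ) 2 := f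

/-- The vector of the sector with given square summable coefficients. -/
def Sector.ofLp {d n : ℕ} (f : lp (fun _ : Occ d n => ℂ) 2) : Sector d n := f

instance (d n : ℕ) : CoeFun (Sector d n) (fun _ => Occ d n → ℂ) := ⟨fun f => ⇑f.toLp⟩

theorem Sector.norm_toLp {d n : ℕ} (f : Sector d n) : ‖f.toLp‖ = ‖f‖ := rfl

@[ext]
theorem Sector.ext {d n : ℕ} {f g : Sector d n} (h : ∀ c, f c = g c) : f = g :=
  lp.ext (funext h)

/-- One more particle in the mode `j`. -/
def addOne {d n : ℕ} (j : Mode d) (c : Occ d n) : Occ d (n + 1) :=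
  ⟨c.1 + Finsupp.single j 1, by rw [map_add, c.2, Finsupp.degree_single]⟩

theorem addOne_injective {d n : ℕ} (j : Mode d) :
    Function.Injective (addOne j : Occ d n → Occ d (n + 1)) := by
  intro c c' h
  have h1 := congrArg Subtype.val h
  exact Subtype.ext (add_right_cancel h1)

theorem occ_le {d n : ℕ} (j : Mode d) (c : Occ d n) : c.1 j ≤ n := by
  have h := Finsupp.le_degree j c.1
  rwa [c.2] at h

theorem sum_annih_le {d n : ℕ} (j : Mode d) (f : Sector d (n + 1)) (s : Finset (Occ d n)) :
    ∑ c ∈ s, ‖((Real.sqrt ((c.1 j : ℝ) + 1) : ℝ) : ℂ) * f (addOne j c)‖ ^ (2 : ℝ≥0∞).toReal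
      ≤ (Real.sqrt ((n : ℝ) + 1) * ‖f‖) ^ (2 : ℝ≥0∞).toReal := by
  have h2 : (2 : ℝ≥0∞).toReal = ((2 : ℕ) : ℝ) := by norm_num
  have hf := lp.norm_rpow_eq_tsum (p := 2) (by norm_num) f.toLp
  rw [f.norm_toLp] at hf
  have hs := (memℓp_gen_iff (p := 2) (by norm_num)).1 (lp.memℓp f.toLp)
  rw [h2] at hf hs ⊢
  simp only [Real.rpow_natCast] at hf hs ⊢
  rw [mul_pow, Real.sq_sqrt (by positivity), hf]
  calc ∑ c ∈ s, ‖((Real.sqrt ((c.1 j : ℝ) + 1) : ℝ) : ℂ) * f (addOne j c)‖ ^ 2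
      ≤ ∑ c ∈ s, ((n : ℝ) + 1) * ‖f (addOne j c)‖ ^ 2 := by
        refine Finset.sum_le_sum fun c _ => ?_
        rw [norm_mul, mul_pow, Complex.norm_real, Real.norm_eq_abs, sq_abs,
          Real.sq_sqrt (by positivity)]
        have : (c.1 j : ℝ) ≤ n := by exact_mod_cast occ_le j c
        gcongr
    _ = ((n : ℝ) + 1) * ∑ c ∈ s.map ⟨addOne j, addOne_injective j⟩, ‖f c‖ ^ 2 := by
        rw [Finset.mul_sum, Finset.sum_map]; rfl
    _ ≤ ((n : ℝ) + 1) * ∑' c, ‖f c‖ ^ 2 := by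
        gcongr
        exact hs.sum_le_tsum _ fun _ _ => by positivity

/-- The annihilation operator `a_j` from the `(n+1)`-particle to the `n`-particle sector:
`(a_j f)(c) = √(c_j + 1) f(c + 1_j)`. -/
def annihSucc {d : ℕ} (j : Mode d) (n : ℕ) : Sector d (n + 1) →L[ℂ] Sector d n :=
  LinearMap.mkContinuous
    { toFun := fun f =>
        Sector.ofLp ⟨fun c => ((Real.sqrt ((c.1 j : ℝ) + 1) : ℝ) : ℂ) * f (addOne j c),
          memℓp_gen' (sum_annih_le j f)⟩
      map_add' := fun f g => by
        ext c; exact mul_add _ _ _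
      map_smul' := fun a f => by
        ext c; exact mul_left_comm _ _ _ }
    (Real.sqrt ((n : ℝ) + 1))
    (fun f => lp.norm_le_of_forall_sum_le (by norm_num) (by positivity) (sum_annih_le j f))

/-- The annihilation operator `a_j` on the `n`-particle sector; it vanishes on the vacuum
sector. The creation operator `a_j^*` is its adjoint. -/
def annih {d : ℕ} (j : Mode d) : (n : ℕ) → Sector d n →L[ℂ] Sector d (n - 1)
  | 0 => 0
  | n + 1 => annihSucc j n

/-- The number operator `a_j^* a_j`. -/
def numOp {d : ℕ} (j : Mode d) (n : ℕ) : Sector d n →L[ℂ] Sector d n :=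
  (annih j n).adjoint ∘L annih j n

/-- `a_i a_j` on the `n`-particle sector. -/
def annih₂ {d : ℕ} (i j : Mode d) (n : ℕ) : Sector d n →L[ℂ] Sector d (n - 1 - 1) :=
  annih i (n - 1) ∘L annih j n

theorem sum_proj_le {d n : ℕ} (S : Set (Occ d n)) (f : Sector d n) (s : Finset (Occ d n)) :
    ∑ c ∈ s, ‖S.indicator f c‖ ^ (2 : ℝ≥0∞).toReal ≤ ‖f‖ ^ (2 : ℝ≥0∞).toReal := by
  have hf := lp.norm_rpow_eq_tsum (p := 2) (by norm_num) f.toLp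
  rw [f.norm_toLp] at hf
  have hs := (memℓp_gen_iff (p := 2) (by norm_num)).1 (lp.memℓp f.toLp)
  rw [hf]
  refine (Finset.sum_le_sum fun c _ => ?_).trans (hs.sum_le_tsum s fun _ _ => by positivity)
  gcongr
  exact norm_indicator_le_norm_self _ _

/-- The orthogonal projection onto the closed span of the product states in `S`. -/
def proj {d n : ℕ} (S : Set (Occ d n)) : Sector d n →L[ℂ] Sector d n :=
  LinearMap.mkContinuous
    { toFun := fun f => Sector.ofLp ⟨S.indicator f, memℓp_gen' (sum_proj_le S f)⟩
      map_add' := fun f g => by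
        ext c; exact congrFun (Set.indicator_add S f g) c
      map_smul' := fun a f => by
        ext c; exact congrFun (Set.indicator_const_smul S a f) c }
    1
    (fun f => by
      rw [one_mul]
      exact lp.norm_le_of_forall_sum_le (by norm_num) (norm_nonneg _) (sum_proj_le S f))

/-- The subspace of all `f` for which `w f` is square summable. -/
def mulDomain {d n : ℕ} (w : Occ d n → ℝ) : Submodule ℂ (Sector d n) where
  carrier := {f | Memℓp (fun c => (w c : ℂ) * f c) 2}
  add_mem' := fun {f g} hf hg => by
    have h : (fun c => (w c : ℂ) * (f + g) c) =
        (fun c => (w c : ℂ) * f c) + fun c => (w c : ℂ) * g c := by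
      funext c; exact mul_add _ _ _
    rw [Set.mem_ofPred_eq, h]
    exact Memℓp.add hf hg
  zero_mem' := by
    have h : (fun c => (w c : ℂ) * (0 : Sector d n) c) = 0 := by
      funext c; exact mul_zero _
    rw [Set.mem_ofPred_eq, h]
    exact zero_memℓp
  smul_mem' := fun a f hf => by
    have h : (fun c => (w c : ℂ) * (a • f) c) = a • fun c => (w c : ℂ) * f c := by
      funext c; exact mul_left_comm _ _ _
    rw [Set.mem_ofPred_eq, h]
    exact Memℓp.const_smul hf a

/-- The self-adjoint (in general unbounded) operator of multiplication by `w` in the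
occupation number basis, on its maximal domain. -/
def mulOp {d n : ℕ} (w : Occ d n → ℝ) : Sector d n →ₗ.[ℂ] Sector d n where
  domain := mulDomain w
  toFun :=
    { toFun := fun f => Sector.ofLp ⟨fun c => (w c : ℂ) * f.1 c, f.2⟩
      map_add' := fun f g => by
        ext c; exact mul_add _ _ _
      map_smul' := fun a f => by
        ext c; exact mul_left_comm _ _ _ }

/-! ### The three-modes Bogoliubov Hamiltonian -/

/-- The data of the three-modes system: `N` bosons in a `d`-dimensional periodic box of side
`L`, interacting through the modes `±jstar` with Fourier component `φ` of the pair potential. -/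
structure System (d : ℕ) where
  L : ℝ
  N : ℕ
  jstar : Mode d
  φ : ℝ

namespace System

variable {d : ℕ} (S : System d)

/-- The `N`-particle Hilbert space `𝓕^N`. -/
abbrev Space : Type := Sector d S.N

/-- `k_j²` with `k_j = (2π/L) j`. -/
def kSq (j : Mode d) : ℝ := ∑ a, (2 * Real.pi / S.L * (j a : ℝ)) ^ 2

/-- `Δ₀`, the smallest nonzero kinetic energy. -/
def gap : ℝ := sInf {x | ∃ j : Mode d, j ≠ 0 ∧ x = S.kSq j}

/-- `ε = k_{jstar}² / φ`. -/
def eps : ℝ := S.kSq S.jstar / S.φ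

/-- The Bogoliubov energy of the modes `±jstar`. -/
def energy : ℝ :=
  -(S.kSq S.jstar + S.φ - Real.sqrt (S.kSq S.jstar ^ 2 + 2 * S.φ * S.kSq S.jstar))

/-- `W = (φ/N) a_0^* a_0^* a_{jstar} a_{-jstar}`. -/
def W : S.Space →L[ℂ] S.Space :=
  ((S.φ / S.N : ℝ) : ℂ) •
    ((annih₂ 0 0 S.N).adjoint ∘L annih₂ S.jstar (-S.jstar) S.N)

/-- `W^* = (φ/N) a_0 a_0 a_{jstar}^* a_{-jstar}^*`. -/
def Wstar : S.Space →L[ℂ] S.Space := S.W.adjoint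

/-- `k_{jstar}² + φ a_0^* a_0 / N`. -/
def modeEnergy : S.Space →L[ℂ] S.Space :=
  ((S.kSq S.jstar : ℝ) : ℂ) • ContinuousLinearMap.id ℂ S.Space
    + ((S.φ / S.N : ℝ) : ℂ) • numOp 0 S.N

/-- The part of the Hamiltonian that involves the interacting modes:
`(k² + φ a_0^*a_0/N)(a_{jstar}^* a_{jstar} + a_{-jstar}^* a_{-jstar}) + W + W^*`. -/
def hamHat : S.Space →L[ℂ] S.Space :=
  S.modeEnergy ∘L numOp S.jstar S.N + S.modeEnergy ∘L numOp (-S.jstar) S.N + S.W + S.Wstar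

open Classical in
/-- Kinetic energy of the particles outside the modes `±jstar` in a product state. -/
def kinRest (c : Occ d S.N) : ℝ :=
  c.1.sum fun j m => if j = S.jstar ∨ j = -S.jstar then 0 else S.kSq j * m

/-- The Hamiltonian `H = ∑_{j ≠ ±jstar} k_j² a_j^* a_j + hamHat` on `𝓕^N`. -/
def ham : S.Space →ₗ.[ℂ] S.Space :=
  (S.hamHat : S.Space →ₗ[ℂ] S.Space) +ᵥ mulOp S.kinRest

/-! ### The Feshbach-Schur flow -/

/-- Number of particles in the modes `±jstar` in a product state. -/
def pairNum (c : Occ d S.N) : ℕ := c.1 S.jstar + c.1 (-S.jstar)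

/-- `Q^{(i,i+1)}`: exactly `N - i` or `N - i - 1` particles in the modes `±jstar`. -/
def Q (i : ℕ) : S.Space →L[ℂ] S.Space :=
  proj {c | S.pairNum c + i = S.N ∨ S.pairNum c + (i + 1) = S.N}

/-- `R` is the bounded inverse of `Q (H - z) Q` on the range of `Q`, extended by zero to the
orthogonal complement of that range. -/
def IsResolvent (H : S.Space →ₗ.[ℂ] S.Space) (P : S.Space →L[ℂ] S.Space) (z : ℝ)
    (R : S.Space →L[ℂ] S.Space) : Prop :=
  P ∘L R = R ∧ R ∘L P = R ∧
    (∀ ψ : S.Space, ∃ h : R ψ ∈ H.domain, P (H ⟨R ψ, h⟩ - (z : ℂ) • R ψ) = P ψ) ∧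
    (∀ ψ : H.domain, P ψ = ψ → R (P (H ψ - (z : ℂ) • (ψ : S.Space))) = ψ)

open Classical in
/-- `R_{i,i}(z) = Q^{(i,i+1)} (Q^{(i,i+1)} (H - z) Q^{(i,i+1)})⁻¹ Q^{(i,i+1)}`
(and `0` where this inverse does not exist). -/
def R (i : ℕ) (z : ℝ) : S.Space →L[ℂ] S.Space :=
  if h : ∃ T, S.IsResolvent S.ham (S.Q i) z T then h.choose else 0

/-- The square root `R_{i,i}(z)^{1/2}`. -/
def sqrtR (i : ℕ) (z : ℝ) : S.Space →L[ℂ] S.Space := CFC.sqrt (S.R i z)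

/-- `Γ_{i,i}(z)` for `i = 2 m`. The value `0` at `m = 0` makes the series at `i = 2` equal to
the identity, so that `Γ_{2,2} = W_{2,0} R_{0,0} W^*_{0,2}`; here
`W_{i,i-2} = Q^{(i,i+1)} W Q^{(i-2,i-1)}` and `W^*_{i-2,i} = Q^{(i-2,i-1)} W^* Q^{(i,i+1)}`. -/
def Γ (z : ℝ) : ℕ → (S.Space →L[ℂ] S.Space)
  | 0 => 0
  | m + 1 =>
      (S.Q (2 * (m + 1)) * S.W * S.Q (2 * m)) * S.R (2 * m) z *
        (∑' l : ℕ, (Γ z m * S.R (2 * m) z) ^ l) *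
        (S.Q (2 * m) * S.Wstar * S.Q (2 * (m + 1)))

/-- `Γ̌_{i,i}(z) = ∑_l [R_{i,i}(z)^{1/2} Γ_{i,i}(z) R_{i,i}(z)^{1/2}]^l` for `i = 2 m`;
it is the identity for `m = 0`. -/
def Γcheck (z : ℝ) (m : ℕ) : S.Space →L[ℂ] S.Space :=
  ∑' l : ℕ, (S.sqrtR (2 * m) z * S.Γ z m * S.sqrtR (2 * m) z) ^ l

/-- All the objects that enter the flow at `z` up to the step `i = N - 2` are well defined:
the resolvents exist as bounded positive operators and the series converge in norm. -/
def FlowWellDefined (z : ℝ) : Prop :=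
  ∀ m : ℕ, 2 * m + 2 ≤ S.N →
    S.IsResolvent S.ham (S.Q (2 * m)) z (S.R (2 * m) z) ∧
    (S.R (2 * m) z).IsPositive ∧
    Summable (fun l : ℕ => (S.Γ z m * S.R (2 * m) z) ^ l) ∧
    Summable (fun l : ℕ => (S.sqrtR (2 * m) z * S.Γ z m * S.sqrtR (2 * m) z) ^ l)

/-- `W R_{N-2,N-2}(z)^{1/2} Γ̌_{N-2,N-2}(z) R_{N-2,N-2}(z)^{1/2} W^*`, for even `N ≥ 2`. -/
def effective (z : ℝ) : S.Space →L[ℂ] S.Space :=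
  S.W * S.sqrtR (S.N - 2) z * S.Γcheck z ((S.N - 2) / 2) * S.sqrtR (S.N - 2) z * S.Wstar

open Classical in
/-- `η`, the normalized state with all the `N` particles in the zero mode. -/
def η : S.Space :=
  Sector.ofLp <| lp.single 2 (⟨Finsupp.single 0 S.N, Finsupp.degree_single _ _⟩ : Occ d S.N) (1 : ℂ)

/-- `|η⟩⟨η|`. -/
def Pη : S.Space →L[ℂ] S.Space := InnerProductSpace.rankOne ℂ S.η S.η

/-- The complement of `|η⟩⟨η|` in the subspace of states without particles in the modes
`±jstar`. -/
def PηPerp : S.Space →L[ℂ] S.Space := proj {c | S.pairNum c = 0} - S.Pη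

end System

end Bog

end

/-! `Wstar` moves two particles from the zero mode to the modes `±jstar`, so it sends a product
state `c` to a multiple of the single product state `c⁺ = pairShift S.jstar c`, and `W` undoes this
move. Both change the number of particles in `±jstar` by two, whereas a level `Q i` allows only two
consecutive values. Hence `W` and `Wstar` drop out of `Q (H - z) Q`, the resolvents are diagonal in
the occupation basis, and by induction so are all `Γ` and the effective operator. The problem
becomes a scalar continued fraction along chains `c, c⁺, c⁺⁺, …`: the new eigenvalue at `c` is
`hopSq c / (E(c⁺) - z - x(c⁺))`, with `E = diagEnergy` and `x` the previous eigenvalue (`isDiag_Γ`,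
`isDiag_effective`).

Convergence follows from an explicit supersolution of this recursion, `flowBound`. It stays at least
`φ/4` below `E - z` as soon as `±jstar` holds a particle, so all geometric series have a common
ratio below one (`hopSq_le_flowBound_mul`, `exists_contraction`).

For the norm inequality, the entry at a state `c ≠ η` without particles in `±jstar` is compared with
the entry at `η` for the lowered spectral parameter. The state `η` has at least as many zero-mode
particles `u`, and the kinetic energy of `c`, at least `Δ₀`, outweighs the shift `Δ₀/2`. A larger
`u` raises the energies, but also `hopSq`, which is proportional to `u (u - 1)`. The quotients `u /
(E(c) - z)` and `(u - 1) / (E(c⁺) - z)` both increase in passing to `η`; the second needs `φ/N ≤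
k²`, that is `1/N ≤ ε`. Since the recursion is monotone in these quotients, induction along the
chain gives the comparison, even without the exponential error term. -/

namespace Bog

/-! ### Diagonal operators in the occupation number basis -/

section Diagonal

variable {d n m : ℕ}

theorem Sector.inner_eq_tsum (f g : Sector d n) : ⟪f, g⟫_ℂ = ∑' c, ⟪f c, g c⟫_ℂ :=
  lp.inner_eq_tsum f.toLp g.toLp

theorem Sector.sum_norm_rpow_le (f : Sector d n) (s : Finset (Occ d n)) :
    ∑ c ∈ s, ‖f c‖ ^ (2 : ℝ≥0∞).toReal ≤ ‖f‖ ^ (2 : ℝ≥0∞).toReal :=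
  lp.sum_rpow_le_norm_rpow (by norm_num) f.toLp s

theorem Sector.norm_le_of_apply_le {f g : Sector d n} {q : ℝ} (hq : 0 ≤ q)
    (h : ∀ c, ‖f c‖ ≤ q * ‖g c‖) : ‖f‖ ≤ q * ‖g‖ := by
  refine lp.norm_le_of_forall_sum_le (p := 2) (f := f.toLp) (by norm_num) (by positivity)
    fun s => ?_
  rw [Real.mul_rpow hq (norm_nonneg _)]
  refine le_trans ?_ (mul_le_mul_of_nonneg_left (g.sum_norm_rpow_le s) (by positivity))
  rw [Finset.mul_sum]
  refine Finset.sum_le_sum fun c _ => ?_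
  rw [← Real.mul_rpow hq (norm_nonneg _)]
  exact Real.rpow_le_rpow (norm_nonneg _) (h c) (by norm_num)

open Classical in
/-- The normalized product state with occupation numbers `c`. -/
noncomputable def basisState (c : Occ d n) : Sector d n := Sector.ofLp (lp.single 2 c (1 : ℂ))

open Classical in
theorem basisState_apply (c b : Occ d n) : basisState c b = if b = c then 1 else 0 := by
  change lp.single (E := fun _ : Occ d n => ℂ) 2 c (1 : ℂ) b = _
  rw [lp.single_apply]
  simp [Pi.single_apply]

theorem inner_basisState (c : Occ d n) (f : Sector d n) : ⟪basisState c, f⟫_ℂ = f c := by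
  classical
  have h := lp.inner_single_left (𝕜 := ℂ) (G := fun _ : Occ d n => ℂ) c (1 : ℂ) f.toLp
  refine Eq.trans ?_ (h.trans ?_)
  · unfold basisState
    congr!
  · simp

theorem norm_basisState (c : Occ d n) : ‖basisState c‖ = 1 := by
  classical
  have h : ‖basisState c‖ ^ 2 = 1 := by
    rw [← inner_self_eq_norm_sq (𝕜 := ℂ), inner_basisState, basisState_apply]
    simp
  nlinarith [norm_nonneg (basisState c)]

/-- The adjoint of a weighted composition operator. -/
theorem adjoint_apply_of_weighted {A : Sector d n →L[ℂ] Sector d m} {a : Occ d m → ℝ}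
    {s : Occ d m → Occ d n} (hA : ∀ f b, A f b = (a b : ℂ) * f (s b)) (b : Occ d m)
    (hs : ∀ b', a b' ≠ 0 → s b' = s b → b' = b) (g : Sector d m) :
    A.adjoint g (s b) = (a b : ℂ) * g b := by
  classical
  -- Injectivity of `s` matters only where the weight is nonzero; this admits shifts that have no
  -- meaning where the amplitude vanishes.
  have h : A (basisState (s b)) = (a b : ℂ) • basisState b := by
    ext b'
    rw [hA]
    change _ = (a b : ℂ) * basisState b b'
    rw [basisState_apply, basisState_apply]
    by_cases h0 : a b' = 0
    · by_cases h1 : b' = b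
      · subst h1; simp
      · simp [h0, h1]
    · by_cases h1 : b' = b
      · subst h1; simp
      · simp [h1, mt (hs b' h0) h1]
  rw [← inner_basisState, ContinuousLinearMap.adjoint_inner_right, h, inner_smul_left,
    inner_basisState, Complex.conj_ofReal]

theorem adjoint_apply_eq_zero_of_weighted {A : Sector d n →L[ℂ] Sector d m} {a : Occ d m → ℝ}
    {s : Occ d m → Occ d n} (hA : ∀ f b, A f b = (a b : ℂ) * f (s b)) (c : Occ d n)
    (hs : ∀ b, a b ≠ 0 → s b ≠ c) (g : Sector d m) : A.adjoint g c = 0 := by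
  classical
  have h : A (basisState c) = 0 := by
    ext b
    rw [hA, basisState_apply]
    change _ = (0 : ℂ)
    by_cases h0 : a b = 0
    · simp [h0]
    · simp [hs b h0]
  rw [← inner_basisState, ContinuousLinearMap.adjoint_inner_right, h, inner_zero_left]

/-- `A` is multiplication by `a` in the occupation number basis. -/
def IsDiag (A : Sector d n →L[ℂ] Sector d n) (a : Occ d n → ℝ) : Prop :=
  ∀ f c, A f c = (a c : ℂ) * f c

namespace IsDiag

variable {A B : Sector d n →L[ℂ] Sector d n} {a b : Occ d n → ℝ}

theorem eq (hA : IsDiag A a) (hB : IsDiag B a) : A = B := by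
  ext f c
  rw [hA, hB]

theorem congr (hA : IsDiag A a) (h : ∀ c, a c = b c) : IsDiag A b := by
  rwa [show a = b from funext h] at hA

theorem mul (hA : IsDiag A a) (hB : IsDiag B b) : IsDiag (A * B) (fun c => a c * b c) := by
  intro f c
  rw [mul_apply_eq_comp, hA, hB]
  push_cast
  ring

theorem sub (hA : IsDiag A a) (hB : IsDiag B b) : IsDiag (A - B) (fun c => a c - b c) := by
  intro f c
  change A f c - B f c = _
  rw [hA, hB]
  push_cast
  ring

theorem one : IsDiag (1 : Sector d n →L[ℂ] Sector d n) (fun _ => 1) := by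
  intro f c
  simp

theorem norm_le (hA : IsDiag A a) {q : ℝ} (hq : 0 ≤ q) (h : ∀ c, |a c| ≤ q) : ‖A‖ ≤ q := by
  refine A.opNorm_le_bound hq fun f => Sector.norm_le_of_apply_le hq fun c => ?_
  rw [hA, norm_mul, Complex.norm_real]
  exact mul_le_mul_of_nonneg_right (h c) (norm_nonneg _)

open scoped ComplexOrder in
theorem isPositive (hA : IsDiag A a) (h : ∀ c, 0 ≤ a c) : A.IsPositive := by
  rw [ContinuousLinearMap.isPositive_iff]
  constructor
  · intro f g
    change ⟪A f, g⟫_ℂ = ⟪f, A g⟫_ℂ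
    rw [Sector.inner_eq_tsum, Sector.inner_eq_tsum]
    refine tsum_congr fun c => ?_
    rw [hA, hA]
    simp only [RCLike.inner_apply, map_mul, Complex.conj_ofReal]
    ring
  · intro f
    rw [Sector.inner_eq_tsum]
    refine tsum_nonneg fun c => ?_
    rw [hA]
    have : ⟪(a c : ℂ) * f c, f c⟫_ℂ = ((a c * ‖f c‖ ^ 2 : ℝ) : ℂ) := by
      simp only [RCLike.inner_apply, map_mul, Complex.conj_ofReal]
      push_cast
      rw [← Complex.mul_conj']
      ring
    rw [this]
    exact_mod_cast mul_nonneg (h c) (by positivity)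

theorem exists_of_bounded (a : Occ d n → ℝ) {q : ℝ} (h : ∀ c, |a c| ≤ q) :
    ∃ A : Sector d n →L[ℂ] Sector d n, IsDiag A a := by
  by_cases hne : Nonempty (Occ d n)
  · have hq : 0 ≤ q := (abs_nonneg _).trans (h hne.some)
    have key : ∀ (f : Sector d n) (s : Finset (Occ d n)),
        ∑ c ∈ s, ‖(a c : ℂ) * f c‖ ^ (2 : ℝ≥0∞).toReal ≤ (q * ‖f‖) ^ (2 : ℝ≥0∞).toReal := by
      intro f s
      rw [Real.mul_rpow hq (norm_nonneg _)]
      refine le_trans ?_ (mul_le_mul_of_nonneg_left (f.sum_norm_rpow_le s) (by positivity))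
      rw [Finset.mul_sum]
      refine Finset.sum_le_sum fun c _ => ?_
      rw [← Real.mul_rpow hq (norm_nonneg _), norm_mul, Complex.norm_real]
      exact Real.rpow_le_rpow (by positivity)
        (mul_le_mul_of_nonneg_right (h c) (norm_nonneg _)) (by norm_num)
    refine ⟨LinearMap.mkContinuous
      { toFun := fun f => Sector.ofLp ⟨fun c => (a c : ℂ) * f c, memℓp_gen' (key f)⟩
        map_add' := fun f g => by ext c; exact mul_add _ _ _
        map_smul' := fun x f => by ext c; exact mul_left_comm _ _ _ } q
      (fun f => lp.norm_le_of_forall_sum_le (by norm_num) (by positivity) (key f)),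
      fun f c => rfl⟩
  · exact ⟨0, fun f c => (hne ⟨c⟩).elim⟩

theorem abs_le_norm (hA : IsDiag A a) (c : Occ d n) : |a c| ≤ ‖A‖ := by
  classical
  have h1 := A.le_opNorm (basisState c)
  have h2 : ‖A (basisState c) c‖ ≤ ‖A (basisState c)‖ :=
    lp.norm_apply_le_norm (by norm_num) (A (basisState c)).toLp c
  rw [hA, basisState_apply, if_pos rfl, mul_one, Complex.norm_real, Real.norm_eq_abs] at h2
  rw [norm_basisState, mul_one] at h1
  exact h2.trans h1

/-- By uniqueness of the positive square root, it suffices to exhibit a positive diagonal operator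
with square `A`. -/
theorem sqrt (hA : IsDiag A a) (h : ∀ c, 0 ≤ a c) :
    IsDiag (CFC.sqrt A) (fun c => Real.sqrt (a c)) := by
  have hb : ∀ c, a c ≤ ‖A‖ := fun c => (le_abs_self _).trans (hA.abs_le_norm c)
  obtain ⟨B, hB⟩ := exists_of_bounded (fun c => Real.sqrt (a c)) (q := Real.sqrt ‖A‖)
    (fun c => by rw [abs_of_nonneg (Real.sqrt_nonneg _)]; exact Real.sqrt_le_sqrt (hb c))
  have hBA : B * B = A :=
    ((hB.mul hB).congr fun c => Real.mul_self_sqrt (h c)).eq hA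
  have hB0 : 0 ≤ B := by
    rw [ContinuousLinearMap.nonneg_iff_isPositive]
    exact hB.isPositive fun c => Real.sqrt_nonneg _
  rwa [CFC.sqrt_unique hBA hB0]

theorem summable_pow (hA : IsDiag A a) {q : ℝ} (hq0 : 0 ≤ q) (hq : q < 1) (h : ∀ c, |a c| ≤ q) :
    Summable (fun l : ℕ => A ^ l) :=
  summable_geometric_of_norm_lt_one ((hA.norm_le hq0 h).trans_lt hq)

theorem tsum_pow (hA : IsDiag A a) {q : ℝ} (hq0 : 0 ≤ q) (hq : q < 1) (h : ∀ c, |a c| ≤ q) :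
    IsDiag (∑' l : ℕ, A ^ l) (fun c => 1 / (1 - a c)) := by
  intro f c
  have h1 := mul_neg_geom_series A ((hA.norm_le hq0 h).trans_lt hq)
  have h2 := (one.sub hA) ((∑' l : ℕ, A ^ l) f) c
  rw [← mul_apply_eq_comp, h1] at h2
  have h3 : (1 - a c : ℝ) ≠ 0 := by have := (le_abs_self _).trans (h c); linarith
  have h3' : ((1 - a c : ℝ) : ℂ) ≠ 0 := by exact_mod_cast h3
  rw [one_apply_eq_self] at h2
  rw [h2]
  push_cast at h3' ⊢
  field_simp

end IsDiag

open Classical in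
theorem isDiag_proj (s : Set (Occ d n)) : IsDiag (proj s) (fun c => if c ∈ s then 1 else 0) := by
  intro f c
  change s.indicator f c = _
  by_cases h : c ∈ s <;> simp [h]

end Diagonal

end Bog

namespace Bog

/-! ### Number operators and the pair hopping operator -/

section Ladder

variable {d n : ℕ}

theorem coe_addOne (j : Mode d) (c : Occ d n) : (addOne j c).1 = c.1 + Finsupp.single j 1 := rfl

theorem annihSucc_apply (j : Mode d) (f : Sector d (n + 1)) (c : Occ d n) :
    annihSucc j n f c = ((Real.sqrt ((c.1 j : ℝ) + 1) : ℝ) : ℂ) * f (addOne j c) := rfl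

theorem annih₂_apply (i j : Mode d) (f : Sector d (n + 2)) (c : Occ d n) :
    annih₂ i j (n + 2) f c =
      ((Real.sqrt ((c.1 i : ℝ) + 1) * Real.sqrt (((addOne i c).1 j : ℝ) + 1) : ℝ) : ℂ) *
        f (addOne j (addOne i c)) := by
  push_cast
  rw [mul_assoc]
  rfl

theorem exists_addOne_eq {j : Mode d} {c : Occ d (n + 1)} (h : c.1 j ≠ 0) :
    ∃ b : Occ d n, addOne j b = c := by
  have hle : Finsupp.single j 1 ≤ c.1 := by
    rw [Finsupp.single_le_iff]
    omega
  have hs : c.1 - Finsupp.single j 1 + Finsupp.single j 1 = c.1 := tsub_add_cancel_of_le hle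
  refine ⟨⟨c.1 - Finsupp.single j 1, ?_⟩, Subtype.ext hs⟩
  have h1 := congrArg Finsupp.degree hs
  rw [map_add, c.2, Finsupp.degree_single] at h1
  omega

theorem isDiag_numOp (j : Mode d) (n : ℕ) : IsDiag (numOp j n) (fun c => (c.1 j : ℝ)) := by
  intro f c
  cases n with
  | zero =>
    have : c.1 j = 0 := Nat.le_zero.1 (occ_le j c)
    simp only [this, Nat.cast_zero, Complex.ofReal_zero, zero_mul]
    change (annih j 0).adjoint 0 c = _
    rw [map_zero]
    rfl
  | succ n =>
    change (annihSucc j n).adjoint (annihSucc j n f) c = _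
    by_cases h : c.1 j = 0
    · beta_reduce
      rw [h, adjoint_apply_eq_zero_of_weighted (annihSucc_apply j)]
      · simp
      · intro b _ hb
        rw [← hb, coe_addOne] at h
        simp at h
    · obtain ⟨b, rfl⟩ := exists_addOne_eq h
      rw [adjoint_apply_of_weighted (annihSucc_apply j) b (fun b' _ h => addOne_injective j h),
        annihSucc_apply, ← mul_assoc, ← Complex.ofReal_mul, Real.mul_self_sqrt (by positivity)]
      beta_reduce
      rw [coe_addOne]
      simp

/-- Two particles are moved from the zero mode to the modes `±j`, if possible. -/
noncomputable def pairShift (j : Mode d) (c : Occ d n) : Occ d n :=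
  if h : 2 ≤ c.1 0 then
    ⟨c.1 - Finsupp.single 0 2 + Finsupp.single j 1 + Finsupp.single (-j) 1, by
      have hle : Finsupp.single 0 2 ≤ c.1 := by rwa [Finsupp.single_le_iff]
      have h1 := congrArg Finsupp.degree (tsub_add_cancel_of_le hle)
      rw [map_add, c.2, Finsupp.degree_single] at h1
      rw [map_add, map_add, Finsupp.degree_single, Finsupp.degree_single]
      omega⟩
  -- A default value: the pair amplitude vanishes when the zero mode holds fewer than two particles.
  else c

theorem coe_pairShift (j : Mode d) {c : Occ d n} (h : 2 ≤ c.1 0) :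
    (pairShift j c).1 =
      c.1 - Finsupp.single 0 2 + Finsupp.single j 1 + Finsupp.single (-j) 1 := by
  unfold pairShift
  rw [dif_pos h]

theorem ne_neg_self {j : Mode d} (hj : j ≠ 0) : j ≠ -j := by
  intro h
  refine hj (funext fun a => ?_)
  have := congrFun h a
  simp only [Pi.neg_apply, Pi.zero_apply] at this ⊢
  omega

theorem pairShift_zero {j : Mode d} (hj : j ≠ 0) {c : Occ d n} (h : 2 ≤ c.1 0) :
    (pairShift j c).1 0 = c.1 0 - 2 := by
  rw [coe_pairShift j h]
  simp [hj]

theorem pairShift_self {j : Mode d} (hj : j ≠ 0) {c : Occ d n} (h : 2 ≤ c.1 0) :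
    (pairShift j c).1 j = c.1 j + 1 := by
  rw [coe_pairShift j h]
  simp [hj.symm, (ne_neg_self hj).symm]

theorem pairShift_neg {j : Mode d} (hj : j ≠ 0) {c : Occ d n} (h : 2 ≤ c.1 0) :
    (pairShift j c).1 (-j) = c.1 (-j) + 1 := by
  rw [coe_pairShift j h]
  simp [ne_neg_self hj, hj]

theorem pairShift_of_ne {j i : Mode d} (h0 : i ≠ 0) (h1 : i ≠ j) (h2 : i ≠ -j) {c : Occ d n}
    (h : 2 ≤ c.1 0) : (pairShift j c).1 i = c.1 i := by
  rw [coe_pairShift j h]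
  simp [h0.symm, h1.symm, h2.symm]

theorem pairShift_injOn {j : Mode d} {c c' : Occ d n} (h : 2 ≤ c.1 0)
    (h' : 2 ≤ c'.1 0) (hcc : pairShift j c = pairShift j c') : c = c' := by
  have h1 := congrArg Subtype.val hcc
  rw [coe_pairShift j h, coe_pairShift j h'] at h1
  have h2 := add_right_cancel (add_right_cancel h1)
  have hle : Finsupp.single 0 2 ≤ c.1 := by rwa [Finsupp.single_le_iff]
  have hle' : Finsupp.single 0 2 ≤ c'.1 := by rwa [Finsupp.single_le_iff]
  refine Subtype.ext ?_
  rw [← tsub_add_cancel_of_le hle, h2, tsub_add_cancel_of_le hle']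

/-- The square of the matrix element of `a_0^* a_0^* a_j a_{-j}` between `c` and
`pairShift j c`. -/
noncomputable def pairAmpSq (j : Mode d) (c : Occ d n) : ℝ :=
  (c.1 0 : ℝ) * ((c.1 0 : ℝ) - 1) * (((c.1 j : ℝ) + 1) * ((c.1 (-j) : ℝ) + 1))

theorem pairAmpSq_of_lt {j : Mode d} {c : Occ d n} (h : c.1 0 < 2) : pairAmpSq j c = 0 := by
  unfold pairAmpSq
  interval_cases c.1 0 <;> simp

theorem pairAmpSq_nonneg (j : Mode d) (c : Occ d n) : 0 ≤ pairAmpSq j c := by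
  by_cases h : c.1 0 < 2
  · rw [pairAmpSq_of_lt h]
  · have : (2 : ℝ) ≤ c.1 0 := by exact_mod_cast not_lt.1 h
    have : (0 : ℝ) ≤ (c.1 0 : ℝ) - 1 := by linarith
    unfold pairAmpSq
    positivity

theorem pairOp_apply {j : Mode d} (hj : j ≠ 0) (n : ℕ) (f : Sector d n) (c : Occ d n) :
    ((annih₂ 0 0 n).adjoint ∘L annih₂ j (-j) n) f c =
      (Real.sqrt (pairAmpSq j c) : ℂ) * f (pairShift j c) := by
  match n with
  | 0 =>
    have hc : c.1 0 < 2 := (occ_le 0 c).trans_lt (by norm_num)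
    have h0 : annih₂ j (-j) 0 = 0 := by
      ext f : 1
      exact map_zero (annih j 0)
    rw [h0, pairAmpSq_of_lt hc, ContinuousLinearMap.comp_zero]
    simp only [Real.sqrt_zero, Complex.ofReal_zero, zero_mul]
    rfl
  | 1 =>
    have hc : c.1 0 < 2 := (occ_le 0 c).trans_lt (by norm_num)
    have h0 : annih₂ j (-j) 1 = 0 := rfl
    rw [h0, pairAmpSq_of_lt hc, ContinuousLinearMap.comp_zero]
    simp only [Real.sqrt_zero, Complex.ofReal_zero, zero_mul]
    rfl
  | n + 2 =>
    rw [ContinuousLinearMap.comp_apply]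
    by_cases hc : c.1 0 < 2
    · rw [pairAmpSq_of_lt hc]
      rw [adjoint_apply_eq_zero_of_weighted (annih₂_apply 0 0)]
      · simp
      · intro b _ hb
        rw [← hb, coe_addOne, coe_addOne] at hc
        simp at hc
    · obtain ⟨b, rfl⟩ := exists_addOne_eq (j := 0) (c := c) (by omega)
      obtain ⟨b, rfl⟩ := exists_addOne_eq (j := 0) (c := b) (by
        rw [coe_addOne] at hc; simp at hc; omega)
      rw [adjoint_apply_of_weighted (annih₂_apply 0 0) b
        (fun b' _ h => addOne_injective 0 (addOne_injective 0 h))]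
      have hs : pairShift j (addOne 0 (addOne 0 b)) = addOne (-j) (addOne j b) := by
        refine Subtype.ext ?_
        rw [coe_pairShift j (not_lt.1 hc), coe_addOne, coe_addOne, coe_addOne, coe_addOne,
          add_assoc b.1, ← Finsupp.single_add, add_tsub_cancel_right]
      rw [hs, ← mul_one (f _), annih₂_apply, mul_one, ← mul_assoc, ← Complex.ofReal_mul]
      congr 2
      rw [← Real.sqrt_mul (by positivity), ← Real.sqrt_mul (by positivity),
        ← Real.sqrt_mul (by positivity)]
      congr 1
      have hj' := ne_neg_self hj
      unfold pairAmpSq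
      simp only [coe_addOne]
      simp [hj, hj'.symm]
      left
      ring

end Ladder

end Bog

namespace Bog

/-! ### Matrix elements of the Hamiltonian and the resolvents -/

namespace System

variable {d : ℕ} (S : System d)

/-- The square of the matrix element of `W` between `c` and `pairShift S.jstar c`. -/
noncomputable def hopSq (c : Occ d S.N) : ℝ := (S.φ / S.N) ^ 2 * pairAmpSq S.jstar c

/-- The diagonal matrix element of the Hamiltonian in the product state `c`. -/
noncomputable def diagEnergy (c : Occ d S.N) : ℝ :=
  S.kinRest c + (S.kSq S.jstar + S.φ / S.N * c.1 0) * S.pairNum c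

/-- The product states in the range of `Q i`. -/
def level (i : ℕ) : Set (Occ d S.N) :=
  {c | S.pairNum c + i = S.N ∨ S.pairNum c + (i + 1) = S.N}

open Classical in
/-- The eigenvalues of `R i z`. -/
noncomputable def resolventDiag (i : ℕ) (z : ℝ) (c : Occ d S.N) : ℝ :=
  if c ∈ S.level i then 1 / (S.diagEnergy c - z) else 0

variable {S}

theorem hopSq_nonneg (c : Occ d S.N) : 0 ≤ S.hopSq c :=
  mul_nonneg (sq_nonneg _) (pairAmpSq_nonneg _ _)

theorem hopSq_of_lt {c : Occ d S.N} (h : c.1 0 < 2) : S.hopSq c = 0 := by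
  rw [hopSq, pairAmpSq_of_lt h, mul_zero]

theorem W_apply (hj : S.jstar ≠ 0) (f : S.Space) (c : Occ d S.N) :
    S.W f c = ((S.φ / S.N * Real.sqrt (pairAmpSq S.jstar c) : ℝ) : ℂ) *
      f (pairShift S.jstar c) := by
  push_cast
  rw [mul_assoc, ← pairOp_apply hj]
  unfold W
  push_cast
  rfl

theorem two_le_of_amp_ne_zero {a : ℝ} {j : Mode d} {n : ℕ} {c : Occ d n}
    (h : a * Real.sqrt (pairAmpSq j c) ≠ 0) : 2 ≤ c.1 0 := by
  by_contra hc
  exact h (by rw [pairAmpSq_of_lt (not_le.1 hc), Real.sqrt_zero, mul_zero])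

theorem Wstar_apply_pairShift (hj : S.jstar ≠ 0) (f : S.Space) {c : Occ d S.N} (hc : 2 ≤ c.1 0) :
    S.Wstar f (pairShift S.jstar c) =
      ((S.φ / S.N * Real.sqrt (pairAmpSq S.jstar c) : ℝ) : ℂ) * f c :=
  adjoint_apply_of_weighted (W_apply hj) c
    (fun _ hb h => pairShift_injOn (two_le_of_amp_ne_zero hb) hc h) f

theorem Wstar_apply_eq_zero (hj : S.jstar ≠ 0) (f : S.Space) {c : Occ d S.N}
    (hc : ∀ b : Occ d S.N, 2 ≤ b.1 0 → pairShift S.jstar b ≠ c) : S.Wstar f c = 0 :=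
  adjoint_apply_eq_zero_of_weighted (W_apply hj) c
    (fun b hb => hc b (two_le_of_amp_ne_zero hb)) f

/-- The hop from `c` to its shift is retraced by `W`, so the amplitude enters squared and `g` is
read at the shifted state. This is the mechanism that keeps the whole flow diagonal. -/
theorem isDiag_W_mul_Wstar (hj : S.jstar ≠ 0) {G : S.Space →L[ℂ] S.Space} {g : Occ d S.N → ℝ}
    (hG : IsDiag G g) :
    IsDiag (S.W * G * S.Wstar) (fun c => S.hopSq c * g (pairShift S.jstar c)) := by
  intro f c
  rw [mul_apply_eq_comp, mul_apply_eq_comp, W_apply hj]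
  by_cases hc : c.1 0 < 2
  · beta_reduce
    rw [hopSq_of_lt hc, pairAmpSq_of_lt hc]
    simp
  · rw [hG, Wstar_apply_pairShift hj f (not_lt.1 hc)]
    have h : S.hopSq c = (S.φ / S.N * Real.sqrt (pairAmpSq S.jstar c)) *
        (S.φ / S.N * Real.sqrt (pairAmpSq S.jstar c)) := by
      rw [mul_mul_mul_comm, Real.mul_self_sqrt (pairAmpSq_nonneg _ _), hopSq]
      ring
    beta_reduce
    rw [h]
    push_cast
    ring

theorem pairNum_pairShift (hj : S.jstar ≠ 0) {c : Occ d S.N} (hc : 2 ≤ c.1 0) :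
    S.pairNum (pairShift S.jstar c) = S.pairNum c + 2 := by
  unfold pairNum
  rw [pairShift_self hj hc, pairShift_neg hj hc]
  omega

open Classical in
theorem isDiag_Q (i : ℕ) : IsDiag (S.Q i) (fun c => if c ∈ S.level i then 1 else 0) :=
  isDiag_proj _

theorem Q_apply_of_mem {i : ℕ} (f : S.Space) {c : Occ d S.N} (hc : c ∈ S.level i) :
    S.Q i f c = f c := by
  classical
  rw [isDiag_Q]
  simp [hc]

theorem Q_apply_of_notMem {i : ℕ} (f : S.Space) {c : Occ d S.N} (hc : c ∉ S.level i) :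
    S.Q i f c = 0 := by
  classical
  rw [isDiag_Q]
  simp [hc]

theorem apply_eq_zero_of_Q {i : ℕ} {f : S.Space} (hf : S.Q i f = f) {c : Occ d S.N}
    (hc : c ∉ S.level i) : f c = 0 := by
  rw [← hf, Q_apply_of_notMem f hc]

theorem hamHat_apply (f : S.Space) (c : Occ d S.N) :
    S.hamHat f c = (((S.kSq S.jstar + S.φ / S.N * c.1 0) * S.pairNum c : ℝ) : ℂ) * f c +
      S.W f c + S.Wstar f c := by
  have h : ∀ g : S.Space, S.modeEnergy g c =
      ((S.kSq S.jstar + S.φ / S.N * c.1 0 : ℝ) : ℂ) * g c := by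
    intro g
    change ((S.kSq S.jstar : ℝ) : ℂ) * g c + ((S.φ / S.N : ℝ) : ℂ) * numOp 0 S.N g c = _
    rw [isDiag_numOp]
    push_cast
    ring
  change S.modeEnergy (numOp S.jstar S.N f) c + S.modeEnergy (numOp (-S.jstar) S.N f) c +
    S.W f c + S.Wstar f c = _
  rw [h, h, isDiag_numOp, isDiag_numOp, pairNum]
  push_cast
  ring

theorem ham_apply (f : S.ham.domain) (c : Occ d S.N) :
    S.ham f c = S.hamHat f.1 c + (S.kinRest c : ℂ) * f.1 c := rfl

/-- A hop changes `pairNum` by two and so leaves the level, on which only two consecutive values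
occur. -/
theorem ham_apply_of_Q (hj : S.jstar ≠ 0) {i : ℕ} (f : S.ham.domain) (hf : S.Q i f = f)
    {c : Occ d S.N} (hc : c ∈ S.level i) : S.ham f c = (S.diagEnergy c : ℂ) * f.1 c := by
  have hW : S.W f.1 c = 0 := by
    rw [W_apply hj]
    by_cases h : c.1 0 < 2
    · rw [pairAmpSq_of_lt h]
      simp
    · rw [apply_eq_zero_of_Q hf, mul_zero]
      have := pairNum_pairShift hj (not_lt.1 h)
      simp only [level, Set.mem_ofPred_eq] at hc ⊢
      omega
  have hWs : S.Wstar f.1 c = 0 := by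
    by_cases h : ∃ b : Occ d S.N, 2 ≤ b.1 0 ∧ pairShift S.jstar b = c
    · obtain ⟨b, hb, rfl⟩ := h
      rw [Wstar_apply_pairShift hj _ hb, apply_eq_zero_of_Q hf, mul_zero]
      have := pairNum_pairShift hj hb
      simp only [level, Set.mem_ofPred_eq] at hc ⊢
      omega
    · exact Wstar_apply_eq_zero hj _ fun b hb hbc => h ⟨b, hb, hbc⟩
  rw [ham_apply, hamHat_apply, hW, hWs, diagEnergy]
  push_cast
  ring

/-- Uniqueness identifies the resolvent obtained by choice in `R` with the explicit diagonal one. -/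
theorem IsResolvent.eq {H : S.Space →ₗ.[ℂ] S.Space} {P R R' : S.Space →L[ℂ] S.Space} {z : ℝ}
    (h : S.IsResolvent H P z R) (h' : S.IsResolvent H P z R') : R = R' := by
  ext1 f
  obtain ⟨hd, hf⟩ := h.2.2.1 f
  have h1 := h'.2.2.2 ⟨R f, hd⟩ (DFunLike.congr_fun h.1 f)
  rw [hf] at h1
  exact h1.symm.trans <| DFunLike.congr_fun h'.2.1 f

theorem kSq_nonneg (j : Mode d) : 0 ≤ S.kSq j := Finset.sum_nonneg fun _ _ => sq_nonneg _

theorem kinRest_nonneg (c : Occ d S.N) : 0 ≤ S.kinRest c := by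
  refine Finset.sum_nonneg fun j _ => ?_
  dsimp only
  split_ifs
  · exact le_rfl
  · exact mul_nonneg (kSq_nonneg j) (Nat.cast_nonneg _)

theorem kinRest_le_diagEnergy (hφ : 0 < S.φ) (c : Occ d S.N) :
    S.kinRest c ≤ S.diagEnergy c := by
  have := S.kSq_nonneg S.jstar
  unfold diagEnergy
  have : 0 ≤ (S.kSq S.jstar + S.φ / S.N * c.1 0) * S.pairNum c := by positivity
  linarith

theorem isResolvent_of_isDiag (hφ : 0 < S.φ) (hj : S.jstar ≠ 0) {i : ℕ} {z : ℝ} (hz : z < 0)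
    {T : S.Space →L[ℂ] S.Space} (hT : IsDiag T (S.resolventDiag i z)) :
    S.IsResolvent S.ham (S.Q i) z T := by
  classical
  have hE : ∀ c, 0 < S.diagEnergy c - z := fun c => by
    have := kinRest_le_diagEnergy hφ c
    have := kinRest_nonneg c
    linarith
  have hQT : S.Q i ∘L T = T := by
    refine (((isDiag_Q i).mul hT).congr fun c => ?_).eq hT
    unfold resolventDiag
    split_ifs <;> simp
  refine ⟨hQT, ?_, fun f => ?_, fun f hf => ?_⟩
  · refine ((hT.mul (isDiag_Q i)).congr fun c => ?_).eq hT
    unfold resolventDiag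
    split_ifs <;> simp
  · have hdom : T f ∈ S.ham.domain := by
      -- The only unbounded part of `H` is `kinRest`, and `kinRest ≤ diagEnergy - z` because `z <
      -- 0`; hence `kinRest` times the resolvent is bounded by one.
      obtain ⟨B, hB⟩ := IsDiag.exists_of_bounded
        (fun c => S.kinRest c * S.resolventDiag i z c) (q := 1) (fun c => by
          have h1 := kinRest_le_diagEnergy hφ c
          have h2 := kinRest_nonneg c
          unfold resolventDiag
          split_ifs
          · rw [mul_one_div, abs_of_nonneg (div_nonneg h2 (hE c).le), div_le_one (hE c)]
            linarith
          · simp)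
      change Memℓp (fun c => (S.kinRest c : ℂ) * T f c) 2
      have h : (fun c => (S.kinRest c : ℂ) * T f c) = B f := by
        funext c
        rw [hB, hT]
        push_cast
        ring
      rw [h]
      exact lp.memℓp (B f).toLp
    refine ⟨hdom, ?_⟩
    ext c
    by_cases hc : c ∈ S.level i
    · rw [Q_apply_of_mem _ hc, Q_apply_of_mem _ hc]
      change S.ham ⟨T f, hdom⟩ c - (z : ℂ) * T f c = _
      rw [ham_apply_of_Q hj ⟨T f, hdom⟩ (DFunLike.congr_fun hQT f) hc]
      dsimp only
      rw [hT, resolventDiag, if_pos hc, ← sub_mul, ← Complex.ofReal_sub, ← mul_assoc,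
        ← Complex.ofReal_mul, mul_one_div, div_self (hE c).ne', Complex.ofReal_one, one_mul]
    · rw [Q_apply_of_notMem _ hc, Q_apply_of_notMem _ hc]
  · ext c
    rw [hT]
    by_cases hc : c ∈ S.level i
    · rw [Q_apply_of_mem _ hc]
      change _ * (S.ham f c - (z : ℂ) * f.1 c) = _
      rw [ham_apply_of_Q hj f hf hc, resolventDiag, if_pos hc, ← sub_mul,
        ← Complex.ofReal_sub, ← mul_assoc, ← Complex.ofReal_mul,
        one_div_mul_cancel (hE c).ne', Complex.ofReal_one, one_mul]
    · rw [apply_eq_zero_of_Q hf hc, resolventDiag, if_neg hc]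
      simp

theorem isResolvent_R (hφ : 0 < S.φ) (hj : S.jstar ≠ 0) (i : ℕ) {z : ℝ} (hz : z < 0) :
    S.IsResolvent S.ham (S.Q i) z (S.R i z) ∧ IsDiag (S.R i z) (S.resolventDiag i z) := by
  obtain ⟨T, hT⟩ := IsDiag.exists_of_bounded (S.resolventDiag i z) (q := 1 / -z) (fun c => by
    have h1 := kinRest_le_diagEnergy hφ c
    have h2 := kinRest_nonneg c
    unfold resolventDiag
    split_ifs
    · rw [abs_of_nonneg (by apply one_div_nonneg.2; linarith)]
      exact one_div_le_one_div_of_le (by linarith) (by linarith)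
    · simp [hz.le])
  have hres := isResolvent_of_isDiag hφ hj hz hT
  have hex : ∃ T, S.IsResolvent S.ham (S.Q i) z T := ⟨T, hres⟩
  have hR : S.R i z = hex.choose := dif_pos hex
  have hRT : S.R i z = T := by
    rw [hR]
    exact hex.choose_spec.eq hres
  rw [hRT]
  exact ⟨hres, hT⟩

end System

end Bog

namespace Bog

/-! ### Scalar inequalities behind the a priori bound -/

section Supersolution

variable {σ q : ℝ}

/-- The two factors are the roots of `x² - 2(1 + σ²)x + 1`. -/
theorem critical_mul (hq : q ^ 2 = σ ^ 4 + 2 * σ ^ 2) :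
    (1 + σ ^ 2 - q) * (1 + σ ^ 2 + q) = 1 := by
  linear_combination -hq

/-- In the limit of infinitely many particles, with `s = w = 0`, this expresses that
`t (a + σ)` is a supersolution of the recursion for the eigenvalues of `Γ`. -/
theorem supersolution_step {s a w : ℝ} (hσ : 0 < σ) (hσ1 : σ ≤ 1 / 10)
    (hq : q ^ 2 = σ ^ 4 + 2 * σ ^ 2) (hqσ : 7 / 5 * σ ≤ q) (hq1 : q ≤ 3 / 20) (hs : 0 ≤ s)
    (ha : 1 ≤ a) (hw : 0 ≤ w) (hsw : 2 * a * w ≤ 1 - s) :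
    (s + w) * a ^ 2 ≤ (1 + σ ^ 2 - q) * (a + σ) *
      (((σ ^ 2 + s) * (2 * a) + (1 + σ ^ 2 - q - σ * q)) -
        (1 + σ ^ 2 - q) * (a + 1 + σ) * s) := by
  have hqt := critical_mul hq
  have hq0 : 0 < q := by linarith
  have hσq : σ * q ≤ 3 / 200 := by nlinarith
  have ht : 17 / 20 ≤ 1 + σ ^ 2 - q := by nlinarith [sq_nonneg σ]
  generalize ht' : 1 + σ ^ 2 - q = t at *
  have h1s : 0 ≤ 1 - s := le_trans (by positivity) hsw
  have h2 : 1 / 2 ≤ t ^ 2 - t * (σ * q) := by nlinarith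
  have h3 : (1 + σ ^ 2) = t + q := by linarith
  -- The left side is affine in `s`, so it is split into its values at `s = 0` and `s = 1`; the
  -- latter simplifies by `t (t + 2 q) = 1`.
  have key : t * (((σ ^ 2 + s) * (2 * a) + (t - σ * q)) - t * (a + 1 + σ) * s) =
      2 * a * σ ^ 2 * t * (1 - s) + (1 - s) * (t ^ 2 - t * (σ * q)) +
        s * (a - σ * (1 - t * q) ) := by
    have e1 : t * (t + 2 * q) = 1 := by rw [← hqt]; linear_combination -t * ht'
    linear_combination (2 * a * s * t) * ht' + (-σ * s + a * s) * e1
  -- The finite-size error `w` is absorbed by the `1 - s` part, through `2 a w ≤ 1 - s`.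
  have h4 : w * a ^ 2 ≤ (a + σ) * ((1 - s) * (t ^ 2 - t * (σ * q))) := by
    have : w * a ≤ (1 - s) * (t ^ 2 - t * (σ * q)) := by nlinarith
    nlinarith [mul_nonneg hw (by linarith : (0:ℝ) ≤ a)]
  -- The offset `σ` in `a + σ` pays for the loss `σ q` in the spectral parameter; this works because
  -- `σ ≤ t q`.
  have h5 : s * a ^ 2 ≤ (a + σ) * (s * (a - σ * (1 - t * q))) := by
    have h6 : σ ≤ (a + σ) * (t * q) := by
      have : σ ≤ t * q := by nlinarith
      nlinarith [mul_pos (by linarith : (0:ℝ) < t) hq0]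
    have : (a + σ) * (s * (a - σ * (1 - t * q))) - s * a ^ 2 =
        s * (σ * ((a + σ) * (t * q) - σ)) := by ring
    have := mul_nonneg hs (mul_nonneg hσ.le (sub_nonneg.2 h6))
    linarith
  have h7 : 0 ≤ (a + σ) * (2 * a * σ ^ 2 * t * (1 - s)) := by
    have : 0 ≤ t := by linarith
    positivity
  calc (s + w) * a ^ 2 ≤ (a + σ) * (t * (((σ ^ 2 + s) * (2 * a) + (t - σ * q)) -
        t * (a + 1 + σ) * s)) := by
        rw [key]
        linarith
    _ = _ := by ring

theorem supersolution_gap {s p : ℝ} (hσ : 0 < σ) (hσ1 : σ ≤ 1 / 10) (hqσ : 7 / 5 * σ ≤ q) (hq1 : q ≤ 3 / 20) (hs : 0 ≤ s)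
    (hs1 : s ≤ 1) (hp : 1 ≤ p) :
    (1 + σ ^ 2 - q) * (p / 2 + 1 + σ) * s + 1 / 4 ≤
      (σ ^ 2 + s) * p + (1 + σ ^ 2 - q - σ * q) := by
  have hq0 : 0 < q := by linarith
  have hσq : σ * q ≤ 3 / 200 := by nlinarith
  have ht : 17 / 20 ≤ 1 + σ ^ 2 - q := by nlinarith [sq_nonneg σ]
  have ht1 : 1 + σ ^ 2 - q ≤ 1 := by nlinarith
  generalize 1 + σ ^ 2 - q = t at *
  have h1 : t * (p / 2) * s ≤ p / 2 * s := by
    have : 0 ≤ p / 2 * s := by positivity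
    nlinarith
  have h2 : t * σ * s ≤ s / 10 := by
    have : t * σ ≤ 1 / 10 := by nlinarith
    nlinarith
  have h3 : t * (1 - s) ≥ 17 / 20 * (1 - s) := by nlinarith
  have h4 : p / 2 * s ≥ s / 2 := by nlinarith
  have h5 : 0 ≤ σ ^ 2 * p := by positivity
  nlinarith

end Supersolution

/-! ### The eigenvalue recursion, its a priori bound and convergence -/

namespace System

variable {d : ℕ} (S : System d)

/-- The eigenvalues of `Γ z m`. -/
noncomputable def flowDiag (z : ℝ) : ℕ → Occ d S.N → ℝ
  | 0, _ => 0
  | m + 1, c =>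
      open Classical in
      if c ∈ S.level (2 * (m + 1)) then
        S.hopSq c * (S.resolventDiag (2 * m) z (pairShift S.jstar c) /
          (1 - flowDiag z m (pairShift S.jstar c) *
            S.resolventDiag (2 * m) z (pairShift S.jstar c)))
      else 0

/-- `t = 1 + ε - √(ε² + 2ε)`, the ratio of the Bogoliubov energy to `-φ`. -/
noncomputable def ratio : ℝ := 1 + S.eps - Real.sqrt (S.eps ^ 2 + 2 * S.eps)

/-- An upper bound for the eigenvalues of all the `Γ z m`. -/
noncomputable def flowBound (c : Occ d S.N) : ℝ :=
  S.φ * (S.ratio * ((S.pairNum c : ℝ) / 2 + 1 + Real.sqrt S.eps) * ((c.1 0 : ℝ) / S.N))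

/-- The assumptions under which the flow is controlled. -/
structure Admissible (z : ℝ) : Prop where
  φ_pos : 0 < S.φ
  jstar_ne : S.jstar ≠ 0
  N_pos : 0 < S.N
  eps_pos : 0 < S.eps
  eps_le : S.eps ≤ 1 / 100
  lt : z < -(S.φ * (S.ratio - Real.sqrt S.eps * Real.sqrt (S.eps ^ 2 + 2 * S.eps)))

variable {S}

theorem pairNum_add_le (hj : S.jstar ≠ 0) (c : Occ d S.N) : S.pairNum c + c.1 0 ≤ S.N := by
  have h1 : ∑ i ∈ ({S.jstar, -S.jstar, 0} : Finset (Mode d)), c.1 i ≤ c.1.degree :=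
    Finset.sum_le_sum_of_ne_zero fun i _ hi => Finsupp.mem_support_iff.2 hi
  rw [Finset.sum_insert (by simp [ne_neg_self hj, hj]), Finset.sum_insert (by simp [hj]),
    Finset.sum_singleton, c.2] at h1
  unfold pairNum
  omega

namespace Admissible

variable {z : ℝ}

theorem params (h : S.Admissible z) :
    ∃ σ q : ℝ, Real.sqrt S.eps = σ ∧ Real.sqrt (S.eps ^ 2 + 2 * S.eps) = q ∧ S.eps = σ ^ 2 ∧
      S.ratio = 1 + σ ^ 2 - q ∧ 0 < σ ∧ σ ≤ 1 / 10 ∧ q ^ 2 = σ ^ 4 + 2 * σ ^ 2 ∧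
      7 / 5 * σ ≤ q ∧ q ≤ 3 / 20 := by
  have h0 := h.eps_pos
  have h1 := h.eps_le
  have hs : Real.sqrt S.eps ^ 2 = S.eps := Real.sq_sqrt h0.le
  have hq : Real.sqrt (S.eps ^ 2 + 2 * S.eps) ^ 2 = S.eps ^ 2 + 2 * S.eps :=
    Real.sq_sqrt (by positivity)
  have hs0 : 0 < Real.sqrt S.eps := Real.sqrt_pos.2 h0
  refine ⟨_, _, rfl, rfl, hs.symm, by rw [hs, ratio], hs0, ?_, ?_, ?_, ?_⟩
  · rw [Real.sqrt_le_left (by norm_num)]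
    linarith
  · rw [hq]
    linear_combination (-S.eps - Real.sqrt S.eps ^ 2 - 2) * hs
  -- The constant `7/5` is a rational lower bound for `√2`, as `q² ≥ 2 ε`.
  · refine abs_le_of_sq_le_sq' ?_ (Real.sqrt_nonneg _) |>.2
    rw [hq, mul_pow, hs]
    nlinarith
  · rw [Real.sqrt_le_left (by norm_num)]
    nlinarith

theorem mono (h : S.Admissible z) {z' : ℝ} (hz : z' ≤ z) : S.Admissible z' :=
  { h with lt := hz.trans_lt h.lt }

theorem kSq_eq (h : S.Admissible z) : S.kSq S.jstar = S.φ * S.eps := by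
  rw [eps, mul_div_cancel₀ _ h.φ_pos.ne']

theorem neg (h : S.Admissible z) : z < 0 := by
  obtain ⟨σ, q, h1, h2, -, h4, h5, h6, h7, h8, h9⟩ := h.params
  have hz := h.lt
  rw [h1, h2, h4] at hz
  have : 0 < 1 + σ ^ 2 - q - σ * q := by nlinarith
  have := mul_pos h.φ_pos this
  linarith

theorem diagEnergy_sub_pos (h : S.Admissible z) (c : Occ d S.N) : 0 < S.diagEnergy c - z := by
  have := kinRest_le_diagEnergy h.φ_pos c
  have := kinRest_nonneg c
  linarith [h.neg]

theorem resolventDiag_nonneg (h : S.Admissible z) (i : ℕ) (c : Occ d S.N) :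
    0 ≤ S.resolventDiag i z c := by
  unfold resolventDiag
  split_ifs
  · exact (one_div_pos.2 (h.diagEnergy_sub_pos c)).le
  · exact le_rfl

theorem le_diagEnergy_sub (h : S.Admissible z) (c : Occ d S.N) :
    S.φ * ((S.eps + (c.1 0 : ℝ) / S.N) * S.pairNum c +
      (S.ratio - Real.sqrt S.eps * Real.sqrt (S.eps ^ 2 + 2 * S.eps))) ≤
      S.diagEnergy c - z := by
  have h1 := kinRest_nonneg c
  have h2 := h.lt
  rw [diagEnergy, h.kSq_eq]
  have : S.φ * S.eps + S.φ / S.N * c.1 0 = S.φ * (S.eps + (c.1 0 : ℝ) / S.N) := by ring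
  rw [this]
  linarith

theorem occ_div_le_one (h : S.Admissible z) (c : Occ d S.N) : (c.1 0 : ℝ) / S.N ≤ 1 := by
  rw [div_le_one (by exact_mod_cast h.N_pos)]
  exact_mod_cast occ_le 0 c

theorem flowBound_add_le (h : S.Admissible z) {c : Occ d S.N} (hc : 1 ≤ S.pairNum c) :
    S.flowBound c + S.φ / 4 ≤ S.diagEnergy c - z := by
  refine le_trans ?_ (h.le_diagEnergy_sub c)
  obtain ⟨σ, q, h1, h2, h3, h4, h5, h6, h7, h8, h9⟩ := h.params
  have := supersolution_gap h5 h6 h8 h9 (s := (c.1 0 : ℝ) / S.N) (p := S.pairNum c)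
    (by positivity) (h.occ_div_le_one c) (by exact_mod_cast hc)
  rw [flowBound, h1, h2, h3, h4]
  have := mul_le_mul_of_nonneg_left this h.φ_pos.le
  linarith

theorem ratio_pos (h : S.Admissible z) : 0 < S.ratio := by
  obtain ⟨σ, q, h1, h2, h3, h4, h5, h6, h7, h8, h9⟩ := h.params
  rw [h4]
  nlinarith

theorem flowBound_nonneg (h : S.Admissible z) (c : Occ d S.N) : 0 ≤ S.flowBound c := by
  have := h.φ_pos
  have := h.ratio_pos
  unfold flowBound
  positivity

theorem flowBound_le (h : S.Admissible z) (c : Occ d S.N) :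
    S.flowBound c ≤ S.φ * (S.ratio * ((S.N : ℝ) / 2 + 1 + Real.sqrt S.eps)) := by
  have := h.φ_pos
  have := h.ratio_pos
  have h1 : (S.pairNum c : ℝ) ≤ S.N := by
    exact_mod_cast (Nat.le_add_right _ _).trans (pairNum_add_le h.jstar_ne c)
  have h2 := h.occ_div_le_one c
  unfold flowBound
  refine mul_le_mul_of_nonneg_left ?_ h.φ_pos.le
  calc _ ≤ S.ratio * ((S.pairNum c : ℝ) / 2 + 1 + Real.sqrt S.eps) * 1 := by gcongr
    _ ≤ _ := by rw [mul_one]; gcongr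

/-- The arithmetic-geometric mean inequality for the occupations of `jstar` and `-jstar`. -/
theorem hopSq_le (c : Occ d S.N) :
    S.hopSq c ≤ (S.φ / S.N) ^ 2 * ((c.1 0 : ℝ) * ((c.1 0 : ℝ) - 1) *
      ((S.pairNum c : ℝ) / 2 + 1) ^ 2) := by
  by_cases hc : c.1 0 < 2
  · rw [hopSq_of_lt hc]
    have : 0 ≤ (c.1 0 : ℝ) * ((c.1 0 : ℝ) - 1) := by
      interval_cases c.1 0 <;> simp
    positivity
  · unfold hopSq pairAmpSq pairNum
    have h1 : (2 : ℝ) ≤ c.1 0 := by exact_mod_cast not_lt.1 hc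
    have h2 : 0 ≤ (c.1 0 : ℝ) * ((c.1 0 : ℝ) - 1) := mul_nonneg (by linarith) (by linarith)
    refine mul_le_mul_of_nonneg_left (mul_le_mul_of_nonneg_left ?_ h2) (sq_nonneg _)
    push_cast
    nlinarith [sq_nonneg ((c.1 S.jstar : ℝ) - c.1 (-S.jstar))]

theorem hopSq_le_flowBound_mul (h : S.Admissible z) {c : Occ d S.N} (hc : 2 ≤ c.1 0) :
    S.hopSq c ≤ S.flowBound c *
      (S.diagEnergy (pairShift S.jstar c) - z - S.flowBound (pairShift S.jstar c)) := by
  have hN : (0 : ℝ) < S.N := by exact_mod_cast h.N_pos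
  have hu : (2 : ℝ) ≤ c.1 0 := by exact_mod_cast hc
  have h1 := h.le_diagEnergy_sub (pairShift S.jstar c)
  have h2 : ((S.pairNum c : ℝ)) + c.1 0 ≤ S.N := by exact_mod_cast pairNum_add_le h.jstar_ne c
  refine le_trans ?_ (mul_le_mul_of_nonneg_left (sub_le_sub_right h1 _) (h.flowBound_nonneg c))
  refine (hopSq_le c).trans ?_
  have hz : (((pairShift S.jstar c).1 0 : ℕ) : ℝ) = (c.1 0 : ℝ) - 2 := by
    rw [pairShift_zero h.jstar_ne hc, Nat.cast_sub hc]
    norm_num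
  rw [flowBound, flowBound, pairNum_pairShift h.jstar_ne hc, hz]
  obtain ⟨σ, q, e1, e2, e3, e4, h5, h6, h7, h8, h9⟩ := h.params
  rw [e1, e2, e3, e4]
  have hp : (0 : ℝ) ≤ S.pairNum c := Nat.cast_nonneg _
  push_cast
  generalize (S.pairNum c : ℝ) = p at *
  generalize (c.1 0 : ℝ) = u at *
  generalize (S.N : ℝ) = N at *
  -- Here `s` is the zero-mode density after the hop and `s + w = (u - 1) / N`. The condition `2 a w
  -- ≤ 1 - s` amounts to `p + u ≤ N`.
  have key := supersolution_step h5 h6 h7 h8 h9 (s := (u - 2) / N) (a := p / 2 + 1) (w := 1 / N)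
    (div_nonneg (by linarith) hN.le) (by linarith) (by positivity) (by
      rw [← sub_nonneg]
      have : 1 - (u - 2) / N - 2 * (p / 2 + 1) * (1 / N) = (N - p - u) / N := by
        field_simp
        ring
      rw [this]
      exact div_nonneg (by linarith) hN.le)
  have h10 : 0 ≤ S.φ ^ 2 * (u / N) := by positivity
  have := mul_le_mul_of_nonneg_left key h10
  calc _ = S.φ ^ 2 * (u / N) * (((u - 2) / N + 1 / N) * (p / 2 + 1) ^ 2) := by
        field_simp
        ring
    _ ≤ _ := this
    _ = _ := by ring

/-- The recursion is increasing in the previous eigenvalue while the denominator is positive, so a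
supersolution bounds it inductively. -/
theorem flowDiag_nonneg_and_le (h : S.Admissible z) (m : ℕ) (hm : 2 * m ≤ S.N) (c : Occ d S.N) :
    0 ≤ S.flowDiag z m c ∧ S.flowDiag z m c ≤ S.flowBound c := by
  induction m generalizing c with
  | zero => exact ⟨le_rfl, h.flowBound_nonneg c⟩
  | succ m ih =>
    unfold flowDiag
    split_ifs with hl
    swap
    · exact ⟨le_rfl, h.flowBound_nonneg c⟩
    by_cases hc : c.1 0 < 2
    · rw [hopSq_of_lt hc, zero_mul]
      exact ⟨le_rfl, h.flowBound_nonneg c⟩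
    have hc2 := not_lt.1 hc
    obtain ⟨ih0, ih1⟩ := ih (by omega) (pairShift S.jstar c)
    have hp := pairNum_pairShift h.jstar_ne hc2
    have hls : pairShift S.jstar c ∈ S.level (2 * m) := by
      simp only [level, Set.mem_ofPred_eq] at hl ⊢
      omega
    have hpos := h.diagEnergy_sub_pos (pairShift S.jstar c)
    -- The shifted state has at least two particles in `±jstar`, so the gap `φ/4` is available.
    have hgap := h.flowBound_add_le (c := pairShift S.jstar c) (by omega)
    have hφ := h.φ_pos
    have heq : S.resolventDiag (2 * m) z (pairShift S.jstar c) /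
          (1 - S.flowDiag z m (pairShift S.jstar c) *
            S.resolventDiag (2 * m) z (pairShift S.jstar c)) =
        1 / (S.diagEnergy (pairShift S.jstar c) - z - S.flowDiag z m (pairShift S.jstar c)) := by
      rw [resolventDiag, if_pos hls]
      generalize S.diagEnergy (pairShift S.jstar c) - z = e at *
      have : e - S.flowDiag z m (pairShift S.jstar c) ≠ 0 := by linarith
      field_simp
    have hden : 0 < S.diagEnergy (pairShift S.jstar c) - z -
        S.flowDiag z m (pairShift S.jstar c) := by linarith
    rw [heq, mul_one_div]
    refine ⟨div_nonneg (hopSq_nonneg c) hden.le, ?_⟩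
    rw [div_le_iff₀ hden]
    refine (h.hopSq_le_flowBound_mul hc2).trans ?_
    exact mul_le_mul_of_nonneg_left (by linarith) (h.flowBound_nonneg c)

theorem flowDiag_mul_resolventDiag_nonneg (h : S.Admissible z) {m : ℕ} (hm : 2 * m + 2 ≤ S.N)
    (c : Occ d S.N) : 0 ≤ S.flowDiag z m c * S.resolventDiag (2 * m) z c :=
  mul_nonneg (h.flowDiag_nonneg_and_le m (by omega) c).1 (h.resolventDiag_nonneg _ c)

theorem exists_contraction (h : S.Admissible z) : ∃ q : ℝ, 0 ≤ q ∧ q < 1 ∧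
    ∀ m : ℕ, 2 * m + 2 ≤ S.N → ∀ c : Occ d S.N,
      |S.flowDiag z m c * S.resolventDiag (2 * m) z c| ≤ q := by
  have hφ := h.φ_pos
  have ht := h.ratio_pos
  set X := S.φ * (S.ratio * ((S.N : ℝ) / 2 + 1 + Real.sqrt S.eps)) with hX
  have hX0 : 0 < X := by positivity
  -- An eigenvalue `x ≤ X` with `x + φ/4 ≤ E - z` gives `x / (E - z) ≤ X / (X + φ/4)`.
  refine ⟨X / (X + S.φ / 4), by positivity, by rw [div_lt_one (by positivity)]; linarith, ?_⟩
  intro m hm c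
  rw [abs_of_nonneg (h.flowDiag_mul_resolventDiag_nonneg hm c)]
  by_cases hc : c ∈ S.level (2 * m)
  · have h1 := (h.flowDiag_nonneg_and_le m (by omega) c).2
    have h0 := (h.flowDiag_nonneg_and_le m (by omega) c).1
    have h2 := h.flowBound_le c
    -- `2 m + 2 ≤ N` forces at least one particle in `±jstar` on this level.
    have h3 := h.flowBound_add_le (c := c) (by
      simp only [level, Set.mem_ofPred_eq] at hc
      omega)
    rw [resolventDiag, if_pos hc, mul_one_div,
      div_le_div_iff₀ (h.diagEnergy_sub_pos c) (by positivity)]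
    rw [← hX] at h2
    nlinarith
  · rw [resolventDiag, if_neg hc, mul_zero]
    positivity

theorem flowDiag_mul_resolventDiag_lt_one (h : S.Admissible z) {m : ℕ} (hm : 2 * m + 2 ≤ S.N)
    (c : Occ d S.N) : S.flowDiag z m c * S.resolventDiag (2 * m) z c < 1 := by
  obtain ⟨q, -, hq, hb⟩ := h.exists_contraction
  exact ((le_abs_self _).trans (hb m hm c)).trans_lt hq

theorem isDiag_Γ (h : S.Admissible z) (m : ℕ) (hm : 2 * m ≤ S.N) :
    IsDiag (S.Γ z m) (S.flowDiag z m) := by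
  classical
  induction m with
  | zero =>
    intro f c
    simp only [flowDiag, Complex.ofReal_zero, zero_mul]
    rfl
  | succ m ih =>
    obtain ⟨q, hq0, hq1, hb⟩ := h.exists_contraction
    have hR := (isResolvent_R h.φ_pos h.jstar_ne (2 * m) h.neg).2
    have hS := ((ih (by omega)).mul hR).tsum_pow hq0 hq1 (hb m (by omega))
    have hD := isDiag_W_mul_Wstar h.jstar_ne
      (((isDiag_Q (2 * m)).mul (hR.mul hS)).mul (isDiag_Q (2 * m)))
    have hD' := ((isDiag_Q (S := S) (2 * (m + 1))).mul hD).mul (isDiag_Q (S := S) (2 * (m + 1)))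
    have heq : S.Γ z (m + 1) = S.Q (2 * (m + 1)) *
        (S.W * (S.Q (2 * m) * (S.R (2 * m) z * ∑' l : ℕ, (S.Γ z m * S.R (2 * m) z) ^ l) *
          S.Q (2 * m)) * S.Wstar) * S.Q (2 * (m + 1)) := by
      simp only [Γ, mul_assoc]
    rw [heq]
    refine hD'.congr fun c => ?_
    rw [flowDiag]
    split_ifs with h1 h2
    · ring
    · rw [resolventDiag, if_neg h2]
      ring
    · ring
    · ring

theorem isDiag_sqrtR (h : S.Admissible z) (i : ℕ) :
    IsDiag (S.sqrtR i z) (fun c => Real.sqrt (S.resolventDiag i z c)) :=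
  (isResolvent_R h.φ_pos h.jstar_ne i h.neg).2.sqrt (h.resolventDiag_nonneg i)

theorem isDiag_sqrtR_mul_Γ_mul_sqrtR (h : S.Admissible z) {m : ℕ} (hm : 2 * m ≤ S.N) :
    IsDiag (S.sqrtR (2 * m) z * S.Γ z m * S.sqrtR (2 * m) z)
      (fun c => S.flowDiag z m c * S.resolventDiag (2 * m) z c) := by
  refine (((h.isDiag_sqrtR (2 * m)).mul (h.isDiag_Γ m hm)).mul (h.isDiag_sqrtR (2 * m))).congr
    fun c => ?_
  have := Real.mul_self_sqrt (h.resolventDiag_nonneg (2 * m) c)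
  linear_combination (S.flowDiag z m c) * this

theorem flowWellDefined (h : S.Admissible z) : S.FlowWellDefined z := by
  intro m hm
  obtain ⟨q, hq0, hq1, hb⟩ := h.exists_contraction
  obtain ⟨h1, h2⟩ := isResolvent_R h.φ_pos h.jstar_ne (2 * m) h.neg
  exact ⟨h1, h2.isPositive (h.resolventDiag_nonneg _),
    ((h.isDiag_Γ m (by omega)).mul h2).summable_pow hq0 hq1 (hb m hm),
    (h.isDiag_sqrtR_mul_Γ_mul_sqrtR (by omega)).summable_pow hq0 hq1 (hb m hm)⟩

theorem isDiag_effective (h : S.Admissible z) {m : ℕ} (hm : 2 * m + 2 = S.N) :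
    IsDiag (S.effective z) (fun c => S.hopSq c *
      (S.resolventDiag (2 * m) z (pairShift S.jstar c) /
        (1 - S.flowDiag z m (pairShift S.jstar c) *
          S.resolventDiag (2 * m) z (pairShift S.jstar c)))) := by
  obtain ⟨q, hq0, hq1, hb⟩ := h.exists_contraction
  have hs := h.isDiag_sqrtR (2 * m)
  have hG := (h.isDiag_sqrtR_mul_Γ_mul_sqrtR (m := m) (by omega)).tsum_pow hq0 hq1
    (hb m (by omega))
  have hD := isDiag_W_mul_Wstar h.jstar_ne ((hs.mul hG).mul hs)
  have e1 : S.N - 2 = 2 * m := by omega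
  have e2 : (S.N - 2) / 2 = m := by omega
  have heq : S.effective z = S.W * (S.sqrtR (2 * m) z *
      (∑' l : ℕ, (S.sqrtR (2 * m) z * S.Γ z m * S.sqrtR (2 * m) z) ^ l) *
      S.sqrtR (2 * m) z) * S.Wstar := by
    simp only [effective, Γcheck, e2]
    simp only [e1, mul_assoc]
  rw [heq]
  refine hD.congr fun c => ?_
  have := Real.mul_self_sqrt (h.resolventDiag_nonneg (2 * m) (pairShift S.jstar c))
  congr 1
  rw [mul_right_comm, this, mul_one_div]

end Admissible

end System

end Bog

namespace Bog

/-! ### Comparison with the condensate state -/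

namespace System

variable {d : ℕ} {S : System d}

/-- The occupation numbers of the state `η`. -/
noncomputable def ηOcc (S : System d) : Occ d S.N :=
  ⟨Finsupp.single 0 S.N, Finsupp.degree_single _ _⟩

theorem η_eq : S.η = basisState S.ηOcc := rfl

open Classical in
theorem isDiag_Pη : IsDiag S.Pη (fun c => if c = S.ηOcc then 1 else 0) := by
  intro f c
  change (⟪S.η, f⟫_ℂ • S.η : S.Space) c = _
  change ⟪S.η, f⟫_ℂ * S.η c = _
  rw [η_eq, inner_basisState, basisState_apply]
  by_cases h : c = S.ηOcc
  · subst h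
    simp
  · simp [h]

open Classical in
theorem isDiag_PηPerp : IsDiag S.PηPerp
    (fun c => (if S.pairNum c = 0 then 1 else 0) - (if c = S.ηOcc then 1 else 0)) :=
  ((isDiag_proj {c : Occ d S.N | S.pairNum c = 0}).sub isDiag_Pη).congr fun c => by
    simp only [Set.mem_ofPred_eq]
    congr

theorem kSq_zero : S.kSq 0 = 0 := by simp [kSq]

/-- The zero mode has no kinetic energy and `±jstar` are not counted, so this quantity is constant
along a chain. -/
theorem kinRest_pairShift {c : Occ d S.N} (hc : 2 ≤ c.1 0) :
    S.kinRest (pairShift S.jstar c) = S.kinRest c := by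
  classical
  unfold kinRest
  rw [Finsupp.sum_of_support_subset (s := c.1.support ∪ (pairShift S.jstar c).1.support) _
      Finset.subset_union_right _ (by simp),
    Finsupp.sum_of_support_subset (s := c.1.support ∪ (pairShift S.jstar c).1.support) _
      Finset.subset_union_left _ (by simp)]
  refine Finset.sum_congr rfl fun i _ => ?_
  split_ifs with h
  · rfl
  · rw [not_or] at h
    by_cases h0 : i = 0
    · rw [h0, kSq_zero, zero_mul, zero_mul]
    · rw [pairShift_of_ne h0 h.1 h.2 hc]

theorem gap_nonneg : 0 ≤ S.gap :=
  Real.sInf_nonneg (by rintro _ ⟨j, -, rfl⟩; exact kSq_nonneg j)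

theorem gap_le_kSq {j : Mode d} (hj : j ≠ 0) : S.gap ≤ S.kSq j :=
  csInf_le ⟨0, by rintro _ ⟨j, -, rfl⟩; exact kSq_nonneg j⟩ ⟨j, hj, rfl⟩

theorem kSq_jstar_pos (hL : 0 < S.L) (hj : S.jstar ≠ 0) : 0 < S.kSq S.jstar := by
  obtain ⟨a, ha⟩ := Function.ne_iff.1 hj
  refine Finset.sum_pos' (fun _ _ => sq_nonneg _) ⟨a, Finset.mem_univ _, ?_⟩
  have : (S.jstar a : ℝ) ≠ 0 := by exact_mod_cast ha
  have := Real.pi_pos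
  positivity

theorem gap_le_kinRest {c : Occ d S.N} (hp : S.pairNum c = 0) (hc : c ≠ S.ηOcc) :
    S.gap ≤ S.kinRest c := by
  classical
  obtain ⟨i, hi0, hi⟩ : ∃ i : Mode d, i ≠ 0 ∧ c.1 i ≠ 0 := by
    by_contra! h
    have h1 : c.1 = Finsupp.single 0 (c.1 0) := by
      ext i
      by_cases hi : i = 0
      · simp [hi]
      · simp [h i hi, Ne.symm hi]
    have h2 := c.2
    rw [h1, Finsupp.degree_single] at h2
    refine hc (Subtype.ext ?_)
    rw [h1, h2]
    rfl
  have hne : ¬(i = S.jstar ∨ i = -S.jstar) := by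
    unfold pairNum at hp
    rintro (rfl | rfl) <;> omega
  have h1 : S.kSq i * c.1 i ≤ S.kinRest c := by
    have := Finset.single_le_sum (f := fun j => if j = S.jstar ∨ j = -S.jstar then (0 : ℝ)
      else S.kSq j * c.1 j) (s := c.1.support) (fun j _ => by
        split_ifs
        · exact le_rfl
        · exact mul_nonneg (kSq_nonneg j) (Nat.cast_nonneg _)) (Finsupp.mem_support_iff.2 hi)
    simp only [if_neg hne] at this
    refine this.trans_eq (Finset.sum_congr rfl fun j _ => ?_)
    congr
  refine (gap_le_kSq hi0).trans (le_trans ?_ h1)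
  have : (1 : ℝ) ≤ c.1 i := by exact_mod_cast Nat.one_le_iff_ne_zero.2 hi
  nlinarith [S.kSq_nonneg i]

/-- `c` and `c'` have the same occupation of the modes `±jstar`, while `c` has fewer particles in
the zero mode and more energy, relative to the spectral parameters, in the other modes. -/
structure Dominated (S : System d) (z z' : ℝ) (c c' : Occ d S.N) : Prop where
  jstar_eq : c.1 S.jstar = c'.1 S.jstar
  neg_jstar_eq : c.1 (-S.jstar) = c'.1 (-S.jstar)
  zero_le : c.1 0 ≤ c'.1 0
  kinRest_le : S.kinRest c' - z' ≤ S.kinRest c - z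

namespace Dominated

variable {z z' : ℝ} {c c' : Occ d S.N}

theorem pairNum_eq (h : S.Dominated z z' c c') : S.pairNum c = S.pairNum c' := by
  rw [pairNum, pairNum, h.jstar_eq, h.neg_jstar_eq]

theorem mem_level_iff (h : S.Dominated z z' c c') (i : ℕ) :
    c ∈ S.level i ↔ c' ∈ S.level i := by
  simp only [level, Set.mem_ofPred_eq, h.pairNum_eq]

theorem pairShift (h : S.Dominated z z' c c') (hj : S.jstar ≠ 0) (hc : 2 ≤ c.1 0) :
    S.Dominated z z' (pairShift S.jstar c) (Bog.pairShift S.jstar c') where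
  jstar_eq := by
    rw [pairShift_self hj hc, pairShift_self hj (hc.trans h.zero_le), h.jstar_eq]
  neg_jstar_eq := by
    rw [pairShift_neg hj hc, pairShift_neg hj (hc.trans h.zero_le), h.neg_jstar_eq]
  zero_le := by
    rw [pairShift_zero hj hc, pairShift_zero hj (hc.trans h.zero_le)]
    exact Nat.sub_le_sub_right h.zero_le 2
  kinRest_le := by
    rw [kinRest_pairShift hc, kinRest_pairShift (hc.trans h.zero_le)]
    exact h.kinRest_le

/-- Monotonicity of `u / (E - z)`: the energy is affine in `u` with a nonnegative constant term, so
it grows at most proportionally to `u`. -/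
theorem zero_mul_diagEnergy_le (h : S.Dominated z z' c c') (hz' : S.Admissible z') :
    (c.1 0 : ℝ) * (S.diagEnergy c' - z') ≤ (c'.1 0 : ℝ) * (S.diagEnergy c - z) := by
  have h1 : (c.1 0 : ℝ) ≤ c'.1 0 := by exact_mod_cast h.zero_le
  have h2 := h.kinRest_le
  have h3 : 0 ≤ S.kinRest c' - z' := by linarith [kinRest_nonneg c', hz'.neg]
  have h4 : 0 ≤ S.kSq S.jstar * S.pairNum c' := mul_nonneg (kSq_nonneg _) (Nat.cast_nonneg _)
  have h5 : (0 : ℝ) ≤ c.1 0 := Nat.cast_nonneg _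
  unfold diagEnergy
  rw [h.pairNum_eq]
  nlinarith [mul_le_mul h1 h2 h3 (h5.trans h1), mul_le_mul_of_nonneg_right h1 h4]

theorem zero_add_one_mul_diagEnergy_le (h : S.Dominated z z' c c') (hz' : S.Admissible z')
    (hN : S.φ / S.N ≤ S.kSq S.jstar) :
    ((c.1 0 : ℝ) + 1) * (S.diagEnergy c' - z') ≤ ((c'.1 0 : ℝ) + 1) * (S.diagEnergy c - z) := by
  have h1 : (c.1 0 : ℝ) ≤ c'.1 0 := by exact_mod_cast h.zero_le
  have h2 := h.kinRest_le
  have h3 : 0 ≤ S.kinRest c' - z' := by linarith [kinRest_nonneg c', hz'.neg]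
  -- Expanding the energy in `u + 1` instead of `u` lowers the constant term by `φ/N` per particle
  -- in `±jstar`; `hN` keeps it nonnegative.
  have h4 : 0 ≤ (S.kSq S.jstar - S.φ / S.N) * S.pairNum c' :=
    mul_nonneg (by linarith) (Nat.cast_nonneg _)
  have h5 : (0 : ℝ) ≤ c.1 0 := Nat.cast_nonneg _
  unfold diagEnergy
  rw [h.pairNum_eq]
  have h6 := mul_le_mul (add_le_add_left h1 1) h2 h3 (by linarith)
  have h7 := mul_le_mul_of_nonneg_right h1 h4
  linarith

/-- After the hop `u - 2` particles remain in the zero mode, so the factor `u - 1` of `hopSq` pairs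
with the resolvent at the shifted state. The other factor `u`, divided out by cross multiplication,
is kept for the resolvent at `c`. -/
theorem hopSq_mul_resolventDiag_le (h : S.Dominated z z' c c') (hz : S.Admissible z)
    (hz' : S.Admissible z') (hN : S.φ / S.N ≤ S.kSq S.jstar) (hc : 2 ≤ c.1 0) (i : ℕ) :
    S.hopSq c * S.resolventDiag i z (Bog.pairShift S.jstar c) * (c'.1 0 : ℝ) ≤
      S.hopSq c' * S.resolventDiag i z' (Bog.pairShift S.jstar c') * (c.1 0 : ℝ) := by
  have hs := h.pairShift hz.jstar_ne hc
  have hc' := hc.trans h.zero_le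
  unfold resolventDiag
  by_cases hl : Bog.pairShift S.jstar c ∈ S.level i
  swap
  · rw [if_neg hl, if_neg (mt (hs.mem_level_iff i).2 hl)]
    simp
  rw [if_pos hl, if_pos ((hs.mem_level_iff i).1 hl)]
  have h1 := hs.zero_add_one_mul_diagEnergy_le hz' hN
  have e1 := hz.diagEnergy_sub_pos (Bog.pairShift S.jstar c)
  have e2 := hz'.diagEnergy_sub_pos (Bog.pairShift S.jstar c')
  rw [pairShift_zero hz.jstar_ne hc, pairShift_zero hz.jstar_ne hc', Nat.cast_sub hc,
    Nat.cast_sub hc'] at h1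
  generalize S.diagEnergy (Bog.pairShift S.jstar c) - z = e at *
  generalize S.diagEnergy (Bog.pairShift S.jstar c') - z' = e' at *
  unfold hopSq pairAmpSq
  rw [h.jstar_eq, h.neg_jstar_eq]
  have h2 : ((c.1 0 : ℝ) - 1) / e ≤ ((c'.1 0 : ℝ) - 1) / e' := by
    rw [div_le_div_iff₀ e1 e2]
    push_cast at h1
    linarith
  have h3 : 0 ≤ (S.φ / S.N) ^ 2 * ((((c'.1 S.jstar : ℝ)) + 1) * ((c'.1 (-S.jstar) : ℝ) + 1)) *
      ((c.1 0 : ℝ) * c'.1 0) := by positivity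
  have h4 := mul_le_mul_of_nonneg_left h2 h3
  calc _ = _ := by ring
    _ ≤ _ := h4
    _ = _ := by ring

theorem hopSq_mul_resolventDiag_le' (h : S.Dominated z z' c c') (hz : S.Admissible z)
    (hz' : S.Admissible z') (hN : S.φ / S.N ≤ S.kSq S.jstar) (hc : 2 ≤ c.1 0) (i : ℕ) :
    S.hopSq c * S.resolventDiag i z (Bog.pairShift S.jstar c) ≤
      S.hopSq c' * S.resolventDiag i z' (Bog.pairShift S.jstar c') := by
  have h0 : (2 : ℝ) ≤ c.1 0 := by exact_mod_cast hc
  have h1 : (c.1 0 : ℝ) ≤ c'.1 0 := by exact_mod_cast h.zero_le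
  have h2 := mul_nonneg (hopSq_nonneg c')
    (hz'.resolventDiag_nonneg i (Bog.pairShift S.jstar c'))
  refine le_of_mul_le_mul_right ((h.hopSq_mul_resolventDiag_le hz hz' hN hc i).trans ?_)
    (by linarith : (0 : ℝ) < c'.1 0)
  exact mul_le_mul_of_nonneg_left h1 h2

/-- With `y` the product of eigenvalue and resolvent, the recursion reads `y(c) = hopSq c · r(c) ·
r(c⁺) / (1 - y(c⁺))`. Domination passes to shifted states, so the denominator is compared
inductively. In the numerator each factor of `u (u - 1)` is matched with its own resolvent. -/
theorem flowDiag_mul_resolventDiag_le (hz : S.Admissible z) (hz' : S.Admissible z')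
    (hN : S.φ / S.N ≤ S.kSq S.jstar) (m : ℕ) (hm : 2 * m + 2 ≤ S.N) (c c' : Occ d S.N)
    (h : S.Dominated z z' c c') :
    S.flowDiag z m c * S.resolventDiag (2 * m) z c ≤
      S.flowDiag z' m c' * S.resolventDiag (2 * m) z' c' := by
  induction m generalizing c c' with
  | zero => simp [flowDiag]
  | succ m ih =>
    have hnn := hz'.flowDiag_mul_resolventDiag_nonneg hm c'
    by_cases hl : c ∈ S.level (2 * (m + 1))
    swap
    · rw [resolventDiag, if_neg hl, mul_zero]
      exact hnn
    have hl' := (h.mem_level_iff _).1 hl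
    by_cases hc : c.1 0 < 2
    · rw [flowDiag, if_pos hl, hopSq_of_lt hc, zero_mul, zero_mul]
      exact hnn
    have hc2 := not_lt.1 hc
    have hx := ih (by omega) _ _ (h.pairShift hz.jstar_ne hc2)
    have hx1 := hz'.flowDiag_mul_resolventDiag_lt_one (m := m) (by omega)
      (Bog.pairShift S.jstar c')
    have hT := h.hopSq_mul_resolventDiag_le hz hz' hN hc2 (2 * m)
    have hE := h.zero_mul_diagEnergy_le hz'
    have e1 := hz.diagEnergy_sub_pos c
    have e2 := hz'.diagEnergy_sub_pos c'
    have hT0 := mul_nonneg (hopSq_nonneg c)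
      (hz.resolventDiag_nonneg (2 * m) (Bog.pairShift S.jstar c))
    have hT0' := mul_nonneg (hopSq_nonneg c')
      (hz'.resolventDiag_nonneg (2 * m) (Bog.pairShift S.jstar c'))
    rw [flowDiag, flowDiag, if_pos hl, if_pos hl', ← mul_div_assoc, ← mul_div_assoc]
    rw [resolventDiag.eq_1 S (2 * (m + 1)) z, resolventDiag.eq_1 S (2 * (m + 1)) z', if_pos hl,
      if_pos hl', mul_one_div, mul_one_div, div_right_comm, div_right_comm _ (1 - _)]
    have h0 : (2 : ℝ) ≤ c.1 0 := by exact_mod_cast hc2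
    have h1 : (c.1 0 : ℝ) ≤ c'.1 0 := by exact_mod_cast h.zero_le
    refine div_le_div₀ (div_nonneg hT0' e2.le) ?_ (by linarith) (by linarith)
    rw [div_le_div_iff₀ e1 e2]
    refine le_of_mul_le_mul_right ?_ (by linarith : (0 : ℝ) < c'.1 0)
    calc _ ≤ S.hopSq c' * S.resolventDiag (2 * m) z' (Bog.pairShift S.jstar c') *
          (c.1 0 : ℝ) * (S.diagEnergy c' - z') := by
          rw [mul_right_comm]
          exact mul_le_mul_of_nonneg_right hT e2.le
      _ ≤ _ := by
          rw [mul_assoc, mul_assoc _ (S.diagEnergy c - z), mul_comm (S.diagEnergy c - z)]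
          exact mul_le_mul_of_nonneg_left hE hT0'

end Dominated

theorem dominated_ηOcc {z : ℝ} {c : Occ d S.N} (hj : S.jstar ≠ 0) (hp : S.pairNum c = 0)
    (hc : c ≠ S.ηOcc) : S.Dominated z (z - S.gap / 2) c S.ηOcc := by
  classical
  have h0 : ∀ i : Mode d, i ≠ 0 → (S.ηOcc).1 i = 0 := fun i hi => by
    simp [ηOcc, Ne.symm hi]
  have hp' := hp
  unfold pairNum at hp'
  refine ⟨?_, ?_, ?_, ?_⟩
  · rw [h0 _ hj]
    omega
  · rw [h0 _ (neg_ne_zero.2 hj)]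
    omega
  · simpa [ηOcc] using occ_le 0 c
  · have h1 : S.kinRest S.ηOcc = 0 := by
      refine Finset.sum_eq_zero fun i _ => ?_
      dsimp only
      split_ifs
      · rfl
      · by_cases hi : i = 0
        · rw [hi, kSq_zero, zero_mul]
        · rw [h0 i hi, Nat.cast_zero, mul_zero]
    have := gap_le_kinRest hp hc
    have := S.gap_nonneg
    linarith

theorem norm_PηPerp_effective_le {z : ℝ} (hz : S.Admissible z)
    (hN : S.φ / S.N ≤ S.kSq S.jstar) (hN2 : 2 ≤ S.N) (hNe : Even S.N) :
    ‖S.PηPerp * S.effective z * S.PηPerp‖ ≤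
      ‖S.Pη * S.effective (z - S.gap / 2) * S.Pη‖ := by
  classical
  have hz' : S.Admissible (z - S.gap / 2) := hz.mono (by linarith [S.gap_nonneg])
  obtain ⟨m, hm⟩ : ∃ m, 2 * m + 2 = S.N := by
    obtain ⟨k, hk⟩ := hNe
    exact ⟨k - 1, by omega⟩
  -- A diagonal entry bounds the norm on the right from below, while the norm on the left is bounded
  -- by a common bound for its entries.
  have hη := ((isDiag_Pη.mul (hz'.isDiag_effective hm)).mul isDiag_Pη).abs_le_norm S.ηOcc
  rw [if_pos rfl, one_mul, mul_one] at hη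
  refine ((isDiag_PηPerp.mul (hz.isDiag_effective hm)).mul isDiag_PηPerp).norm_le
    (norm_nonneg _) fun c => ?_
  by_cases hcη : c = S.ηOcc
  · have : S.pairNum c = 0 := by
      rw [hcη]
      simp [pairNum, ηOcc, hz.jstar_ne]
    rw [if_pos this, if_pos hcη]
    simp
  by_cases hp : S.pairNum c = 0
  swap
  · simp [hp, hcη]
  rw [if_pos hp, if_neg hcη, sub_zero, one_mul, mul_one]
  refine le_trans ?_ hη
  by_cases hc : c.1 0 < 2
  · rw [hopSq_of_lt hc, zero_mul, abs_zero]
    exact abs_nonneg _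
  have hc2 := not_lt.1 hc
  have hd := dominated_ηOcc (z := z) hz.jstar_ne hp hcη
  have h1 := hd.hopSq_mul_resolventDiag_le' hz hz' hN hc2 (2 * m)
  have h2 := Dominated.flowDiag_mul_resolventDiag_le hz hz' hN m (by omega) _ _
    (hd.pairShift hz.jstar_ne hc2)
  have h3 := hz'.flowDiag_mul_resolventDiag_lt_one (m := m) (by omega)
    (pairShift S.jstar S.ηOcc)
  have h4 := mul_nonneg (hopSq_nonneg c)
    (hz.resolventDiag_nonneg (2 * m) (pairShift S.jstar c))
  rw [← mul_div_assoc, ← mul_div_assoc, abs_of_nonneg (div_nonneg h4 (by linarith)),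
    abs_of_nonneg (div_nonneg (h4.trans h1) (by linarith))]
  exact div_le_div₀ (h4.trans h1) h1 (by linarith) (by linarith)

theorem energy_add_eq (hφ : 0 < S.φ) :
    S.energy + Real.sqrt S.eps * S.φ * Real.sqrt (S.eps ^ 2 + 2 * S.eps) =
      -(S.φ * (S.ratio - Real.sqrt S.eps * Real.sqrt (S.eps ^ 2 + 2 * S.eps))) := by
  have hk : S.kSq S.jstar = S.φ * S.eps := by
    rw [eps, mul_div_cancel₀ _ hφ.ne']
  have h : (S.φ * S.eps) ^ 2 + 2 * S.φ * (S.φ * S.eps) =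
      S.φ ^ 2 * (S.eps ^ 2 + 2 * S.eps) := by ring
  rw [energy, hk, h, Real.sqrt_mul (sq_nonneg _), Real.sqrt_sq hφ.le, ratio]
  ring

end System

end Bog

theorem mainTheorem8 (ν : ℝ) (hν : 11 / 8 < ν) (μ : ℝ) (hμ0 : 0 < μ) (hμ1 : μ < 1)
    (θ : ℝ) (hθ : 0 < θ) (K : ℝ) (hK : 0 < K) :
    ∃ ε₀ > (0 : ℝ), ∃ C > (0 : ℝ), ∃ c > (0 : ℝ),
      ∀ (d : ℕ) (S : Bog.System d), 0 < S.L → 0 < S.φ → S.jstar ≠ 0 → 0 < S.N → Even S.N →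
        S.eps ≤ ε₀ →
        1 / (S.N : ℝ) ≤ S.eps ^ ν →
        S.φ / S.gap * ((S.N : ℝ) ^ μ / ((S.N : ℝ) * ((S.N : ℝ) - (S.N : ℝ) ^ μ))) < 1 / 2 →
        1 / (S.N : ℝ) ^ μ ≤ K * Real.sqrt S.eps ^ (1 + θ) →
        ∀ z : ℝ,
          z < S.energy + Real.sqrt S.eps * S.φ * Real.sqrt (S.eps ^ 2 + 2 * S.eps) →
          S.FlowWellDefined z ∧ S.FlowWellDefined (z - S.gap / 2) ∧
          ‖S.PηPerp * S.effective z * S.PηPerp‖ ≤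
            ‖S.Pη * S.effective (z - S.gap / 2) * S.Pη‖ +
              C * (1 / Real.sqrt S.eps * (1 / (1 + c * Real.sqrt S.eps)) ^ ((S.N : ℝ) ^ μ)) := by
  -- The threshold `1/100` is the smallness used in `Admissible`. The error term enters only through
  -- its nonnegativity, so any positive `C` and `c` would do.
  refine ⟨1 / 100, by norm_num, 1, one_pos, 1, one_pos, ?_⟩
  intro d S hL hφ hj hN hNe hε hNε _ _ z hz
  have hε0 : 0 < S.eps := div_pos (Bog.System.kSq_jstar_pos hL hj) hφ
  rw [Bog.System.energy_add_eq hφ] at hz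
  have hadm : S.Admissible z := ⟨hφ, hj, hN, hε0, hε, hz⟩
  have hadm' : S.Admissible (z - S.gap / 2) := hadm.mono (by linarith [S.gap_nonneg])
  -- From `1/N ≤ ε^ν` with `ν ≥ 1` and `ε ≤ 1`; this is the condition `φ/N ≤ k²` needed for the
  -- comparison.
  have hN1 : 1 / (S.N : ℝ) ≤ S.eps := by
    refine hNε.trans ?_
    have := Real.rpow_le_rpow_of_exponent_ge hε0 (by linarith) (by linarith : (1 : ℝ) ≤ ν)
    rwa [Real.rpow_one] at this
  have hNk : S.φ / S.N ≤ S.kSq S.jstar := by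
    rw [hadm.kSq_eq, div_eq_mul_one_div]
    exact mul_le_mul_of_nonneg_left hN1 hφ.le
  refine ⟨hadm.flowWellDefined, hadm'.flowWellDefined, ?_⟩
  refine (Bog.System.norm_PηPerp_effective_le hadm hNk ?_ hNe).trans
    (le_add_of_nonneg_right (by positivity))
  obtain ⟨k, hk⟩ := hNe
  omega
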